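/- Let $L$ be an even positive definite lattice of rank $l$ with bilinear form $(\cdot,\cdot)$, extended $\mathbb C$-bilinearly to $L\otimes\mathbb C$, with dual lattice $L^*$, and let $G$ be a subgroup of the integral orthogonal group $\mathrm O(L)$. For $k\in\mathbb Z$ and $t\in\mathbb Z_{\ge 0}$, a $G$-invariant weak Jacobi form of weight $k$ and index $t$ associated to $L$ is a holomorphic function $\varphi:\mathbb H\times(L\otimes\mathbb C)\to\mathbb C$ such that $$\varphi\Big(\frac{a\tau+b}{c\tau+d},\frac{\mathfrak z}{c\tau+d}\Big)=(c\tau+d)^k\exp\Big(t\pi i\,\frac{c(\mathfrak z,\mathfrak z)}{c\tau+d}\Big)\varphi(\tau,\mathfrak z)\quad\text{for all }\begin{pmatrix}a&b\\c&d\end{pmatrix}\in\mathrm{SL}_2(\mathbb Z),$$ $$\varphi(\tau,\mathfrak z+x\tau+y)=\exp\big(-t\pi i\,[(x,x)\tau+2(x,\mathfrak z)]\big)\varphi(\tau,\mathfrak z)\quad\text{for all }x,y\in L,$$ such that $\varphi$ has a Fourier expansion $\varphi(\tau,\mathfrak z)=\sum_{n=0}^{\infty}\sum_{\ell\in L^*}f(n,\ell)e^{2\pi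 i(n\tau+(\ell,\mathfrak z))}$, and such that $\varphi(\tau,\sigma(\mathfrak z))=\varphi(\tau,\mathfrak z)$ for all $\sigma\in G$. If $G$ is trivial, $\varphi$ is called a weak Jacobi form. For $1\le j\le l+1$ let $\phi_j$ be a $G$-invariant weak Jacobi form of weight $k_j$ and index $m_j$ associated to $L$. Fix linear coordinates $\mathfrak z=(z_1,\dots,z_l)$ of $L\otimes\mathbb C$ and define $$J=J(\phi_1,\dots,\phi_{l+1})=\begin{vmatrix} m_1\phi_1&\cdots&m_{l+1}\phi_{l+1}\\ \frac{\partial\phi_1}{\partial z_1}&\cdots&\frac{\partial\phi_{l+1}}{\partial z_1}\\ \vdots&\ddots&\vdots\\ \frac{\partial\phi_1}{\partial z_l}&\cdots&\frac{\partial\phi_{l+1}}{\partial z_l}\end{vmatrix}.$$ 1. $J$ is a weak Jacobi form of weight $l+\sum_{j=1}^{l+1}k_j$ and index $\sum_{j=1}^{l+1}m_j$ associated to $L$, and $J(\tau,\sigma(\mathfrak z))=\det(\sigma)\,J(\tau,\mathfrak z)$ for all $\sigma\in G$. 2. If $l\ge 1$, then $J$ is not identically zero if and only if the functions $\phi_1,\dots,\phi_{l+1}$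 are algebraically independent over the graded ring $M_*(\mathrm{SL}_2(\mathbb Z))=\bigoplus_{k\in\mathbb Z}M_k(\mathrm{SL}_2(\mathbb Z))$ of holomorphic modular forms, regarded as functions on $\mathbb H\times(L\otimes\mathbb C)$ that do not depend on $\mathfrak z$. 3. Let $r$ be a primitive vector of $L$. If the reflection $\sigma_r:v\mapsto v-\frac{2(r,v)}{(r,r)}r$ of $L\otimes\mathbb C$ belongs to $G$, then $J$ vanishes on $$D_r(\tau)=\{(\tau,\mathfrak z)\in\mathbb H\times(L\otimes\mathbb C):(r^\vee,\mathfrak z)\in\mathbb Z\tau\oplus\mathbb Z\},\qquad r^\vee=\frac{2r}{(r,r)}.$$ -/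

import Mathlib

open UpperHalfPlane TensorProduct DirectSum
open scoped MatrixGroups ModularForm

noncomputable section

namespace LatticeJacobi

variable {L : Type*} [AddCommGroup L]

/-- `B` makes `L` an even positive definite lattice (`L` being free of finite rank over `ℤ`). -/
structure IsEvenPosDef (B : LinearMap.BilinForm ℤ L) : Prop where
  symm : ∀ x y, B x y = B y x
  even : ∀ x, Even (B x x)
  posDef : ∀ x, x ≠ 0 → 0 < B x x

/-- The integral orthogonal group `O(L)`. -/
def orthogonalGroup (B : LinearMap.BilinForm ℤ L) : Subgroup (L ≃ₗ[ℤ] L) where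
  carrier := {σ | ∀ x y, B (σ x) (σ y) = B x y}
  mul_mem' := by
    intro σ ρ hσ hρ x y
    rw [LinearEquiv.mul_apply, LinearEquiv.mul_apply, hσ, hρ]
  one_mem' := fun _ _ => rfl
  inv_mem' := by
    intro σ hσ x y
    have h := hσ (σ⁻¹ x) (σ⁻¹ y)
    rw [← LinearEquiv.mul_apply, ← LinearEquiv.mul_apply, mul_inv_cancel] at h
    exact h.symm

/-- The complex vector space `L ⊗ ℂ`. -/
abbrev Cplx (L : Type*) [AddCommGroup L] : Type _ := ℂ ⊗[ℤ] L

/-- The inclusion of the lattice into `L ⊗ ℂ`. -/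
def incl (x : L) : Cplx L := (1 : ℂ) ⊗ₜ[ℤ] x

/-- The `ℂ`-bilinear extension of the form of `L` to `L ⊗ ℂ`. -/
def cform (B : LinearMap.BilinForm ℤ L) : LinearMap.BilinForm ℂ (Cplx L) :=
  LinearMap.BilinForm.baseChange ℂ B

/-- The action of an automorphism of `L` on `L ⊗ ℂ`. -/
def cact (σ : L ≃ₗ[ℤ] L) : Cplx L →ₗ[ℂ] Cplx L :=
  LinearMap.baseChange ℂ (σ : L →ₗ[ℤ] L)

/-- The dual lattice `L*`: the vectors of `L ⊗ ℂ` which pair integrally with all of `L`.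
Such a vector lies in `L ⊗ ℚ` as soon as the form is nondegenerate. -/
def dualLattice (B : LinearMap.BilinForm ℤ L) : AddSubgroup (Cplx L) where
  carrier := {v | ∀ x : L, ∃ n : ℤ, cform B v (incl x) = n}
  zero_mem' := fun x => ⟨0, by simp⟩
  add_mem' := by
    intro v w hv hw x
    obtain ⟨a, ha⟩ := hv x
    obtain ⟨b, hb⟩ := hw x
    exact ⟨a + b, by simp [ha, hb]⟩
  neg_mem' := by
    intro v hv x
    obtain ⟨a, ha⟩ := hv x
    exact ⟨-a, by simp [ha]⟩

/-- `φ` is holomorphic on `ℍ × (L ⊗ ℂ)`, i.e. holomorphic in linear coordinates of `L ⊗ ℂ`. -/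
def IsHolomorphic (φ : ℍ → Cplx L → ℂ) : Prop :=
  ∀ (n : ℕ) (b : Module.Basis (Fin n) ℂ (Cplx L)),
    DifferentiableOn ℂ
      (fun p : ℂ × (Fin n → ℂ) => φ (ofComplex p.1) (∑ i, p.2 i • b i))
      {p | 0 < p.1.im}

/-- `φ` is a `G`-invariant weak Jacobi form of weight `k` and index `t` associated to the
lattice `L` with form `B`. (Weak Jacobi forms without an invariance condition are those with
`G = ⊥`.) -/
structure IsWeakJacobiForm (B : LinearMap.BilinForm ℤ L) (G : Subgroup (L ≃ₗ[ℤ] L))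
    (k : ℤ) (t : ℕ) (φ : ℍ → Cplx L → ℂ) : Prop where
  holomorphic : IsHolomorphic φ
  modular : ∀ (γ : SL(2, ℤ)) (τ : ℍ) (z : Cplx L),
    φ (γ • τ) (((γ 1 0 : ℂ) * τ + (γ 1 1 : ℂ))⁻¹ • z) =
      ((γ 1 0 : ℂ) * τ + (γ 1 1 : ℂ)) ^ k *
        Complex.exp (t * Real.pi * Complex.I *
          ((γ 1 0 : ℂ) * cform B z z / ((γ 1 0 : ℂ) * τ + (γ 1 1 : ℂ)))) * φ τ z
  quasiPeriodic : ∀ (x y : L) (τ : ℍ) (z : Cplx L),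
    φ τ (z + (τ : ℂ) • incl x + incl y) =
      Complex.exp (-(t * Real.pi * Complex.I *
        (cform B (incl x) (incl x) * τ + 2 * cform B (incl x) z))) * φ τ z
  fourier : ∃ f : ℕ → dualLattice B → ℂ, ∀ (τ : ℍ) (z : Cplx L),
    HasSum (fun p : ℕ × dualLattice B =>
      f p.1 p.2 * Complex.exp (2 * Real.pi * Complex.I *
        ((p.1 : ℂ) * τ + cform B (p.2 : Cplx L) z))) (φ τ z)
  invariant : ∀ σ ∈ G, ∀ (τ : ℍ) (z : Cplx L), φ τ (cact σ z) = φ τ z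

/-- The partial derivative `∂φ/∂z_i`, for the coordinates `z_1, …, z_l` with respect to the
basis `b` of `L ⊗ ℂ`. -/
def partialZ {l : ℕ} (b : Module.Basis (Fin l) ℂ (Cplx L)) (i : Fin l) (φ : ℍ → Cplx L → ℂ) :
    ℍ → Cplx L → ℂ :=
  fun τ z => deriv (fun s : ℂ => φ τ (z + s • b i)) 0

/-- The matrix with first row `m_j φ_j` and further rows `∂φ_j/∂z_i`. -/
def jacobianMatrix {l : ℕ} (b : Module.Basis (Fin l) ℂ (Cplx L)) (m : Fin (l + 1) → ℕ)
    (φ : Fin (l + 1) → ℍ → Cplx L → ℂ) (τ : ℍ) (z : Cplx L) :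
    Matrix (Fin (l + 1)) (Fin (l + 1)) ℂ :=
  Matrix.of (Fin.cons (fun j => (m j : ℂ) * φ j τ z) (fun i j => partialZ b i (φ j) τ z))

/-- The Jacobian of `l + 1` functions on `ℍ × (L ⊗ ℂ)` with indices `m_j`. -/
def jacobian {l : ℕ} (b : Module.Basis (Fin l) ℂ (Cplx L)) (m : Fin (l + 1) → ℕ)
    (φ : Fin (l + 1) → ℍ → Cplx L → ℂ) : ℍ → Cplx L → ℂ :=
  fun τ z => (jacobianMatrix b m φ τ z).det

/-- The graded ring `M_*(SL₂(ℤ))` of modular forms. -/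
abbrev ModularFormRing : Type := ⨁ k : ℤ, ModularForm 𝒮ℒ k

/-- The ring homomorphism which regards modular forms as functions on `ℍ × (L ⊗ ℂ)` that do
not depend on the lattice variable. -/
def modularFormToFun (L : Type*) [AddCommGroup L] :
    ModularFormRing →+* (ℍ → Cplx L → ℂ) :=
  DirectSum.toSemiring
    (fun _ => { toFun := fun f τ _ => f τ, map_zero' := rfl, map_add' := fun _ _ => rfl })
    rfl (fun _ _ => rfl)

/-- Algebraic independence over `M_*(SL₂(ℤ))` of functions on `ℍ × (L ⊗ ℂ)`. -/
def AlgIndepOverModularForms {n : ℕ} (φ : Fin n → ℍ → Cplx L → ℂ) : Prop :=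
  letI : Algebra ModularFormRing (ℍ → Cplx L → ℂ) := (modularFormToFun L).toAlgebra
  AlgebraicIndependent ModularFormRing φ

/-- `r` is a primitive vector of `L`. -/
def IsPrimitiveVector (r : L) : Prop :=
  r ≠ 0 ∧ ∀ (n : ℤ) (s : L), r = n • s → IsUnit n

/-- The reflection `σ_r(v) = v - 2(r, v)/(r, r) r` of `L ⊗ ℂ`. -/
def reflect (B : LinearMap.BilinForm ℤ L) (r : L) (v : Cplx L) : Cplx L :=
  v - (2 * cform B (incl r) v / cform B (incl r) (incl r)) • incl r

/-- The coroot `r^∨ = 2r/(r, r)`. -/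
def coroot (B : LinearMap.BilinForm ℤ L) (r : L) : Cplx L :=
  (2 / cform B (incl r) (incl r)) • incl r

/-- The set `D_r(τ)` of all `(τ, z)` with `(r^∨, z) ∈ ℤτ ⊕ ℤ`. -/
def mirrors (B : LinearMap.BilinForm ℤ L) (r : L) : Set (ℍ × Cplx L) :=
  {p | ∃ u v : ℤ, cform B (coroot B r) p.2 = u * (p.1 : ℂ) + v}

end LatticeJacobi

end

/-! Transformation laws. The automorphy factor of a form of index `m_j` is a power of `cτ + d`, or
1, times an exponential with exponent proportional to `m_j`. Differentiating it in `z` therefore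
adds to `∂φ_j/∂z_i` a multiple of `m_j φ_j` whose coefficient does not depend on `j`. This is a
multiple of the first row of the Jacobian matrix, so the determinant transforms by the product of
the factors; an automorphism in `G` acts on the other rows by a constant matrix. On a mirror, `σ_r
z` differs from `z` by a vector of `τL + L` whose quasi-period factor is 1 because `L` is even; as
`det σ_r = -1`, `J = -J`.

`J ≠ 0` implies independence. Translations by multiples of `xτ` split a polynomial relation into
parts homogeneous in the index (`polyEval_weightedHomogeneousComponent`). For a homogeneous `P`,
Euler's identity and the chain rule say that the Jacobian matrix kills the vector of the `∂P/∂X_j`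
at `φ`. Hence these are again relations, of lower degree (`pderiv_relation`), and induction ends at
constants.

`J = 0` implies dependence. Fix `τ`. The kernel of the Jacobian matrix over the domain of entire
functions supplies a vector field `U ≠ 0` and a function `u₀` with `U f_j = -m_j u₀ f_j` for the
slices `f_j = φ_j(τ, ·)`, hence `U F = -N u₀ F` for every polynomial `F` in them of index `N`. For
such an `F`, vanishing to order `T` along a hypersurface transversal to `U` at one point already
gives vanishing to order `T` there (`isBigO_of_slice`). This costs only about `T^(l-1)` linear
conditions, against `(s+1)^l` monomials of a common index proportional to `s`. So some nonzero
combination vanishes to an order `T` that is a large multiple of its index. Theta functions of index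
`N` grow on balls at most like `exp (A N)`, and the Schwarz lemma forces the combination to be zero
(`exists_box_relation`).

It remains to replace relations at each `τ` by one over the ring of modular forms. After a twist by
an exponential in `E₂`, the Taylor coefficients at `z = 0` are modular forms. The products
considered for each `s` are then either dependent over this ring, or a nonzero modular form `δ_s`
vanishes wherever they are dependent pointwise (`exists_relation_or_modularForm`). In the second
case for every `s`, the zero sets of the `δ_s` would cover `ℍ`, contrary to Baire's theorem. If some
index is 0, Liouville's theorem makes `φ_j` independent of `z`, and the same argument applies to `1,
φ_j`. -/

noncomputable section

namespace LatticeJacobi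

/-! ### Derivatives and Taylor expansions of holomorphic functions of several variables. -/

section SeveralVariables

open Metric Filter Topology Asymptotics

variable {E : Type*} [NormedAddCommGroup E] [NormedSpace ℂ E]

lemma fderiv_norm_le_of_ball {F : E → ℂ} {x : E} {r M : ℝ} (hr : 0 < r)
    (hF : DifferentiableOn ℂ F (ball x r)) (hM : ∀ y ∈ ball x r, ‖F y‖ ≤ M) :
    ‖fderiv ℂ F x‖ ≤ 2 * M / r := by
  refine Complex.norm_fderiv_le_div_of_mapsTo_ball hF (fun y hy => ?_) hr
  rw [mem_closedBall, dist_eq_norm]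
  calc ‖F y - F x‖ ≤ ‖F y‖ + ‖F x‖ := norm_sub_le _ _
    _ ≤ 2 * M := by linarith [hM y hy, hM x (mem_ball_self hr)]

/-- Cauchy's formula on a small circle in the direction `v` writes the directional derivative as an
integral of values of `F`; this is differentiated under the integral sign, with Cauchy estimates as
dominating bound. -/
lemma differentiableOn_fderiv_apply [FiniteDimensional ℂ E] {F : E → ℂ} {U : Set E}
    (hU : IsOpen U) (hF : DifferentiableOn ℂ F U) (v : E) :
    DifferentiableOn ℂ (fun x => fderiv ℂ F x v) U := by
  intro x₀ hx₀
  refine DifferentiableAt.differentiableWithinAt ?_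
  let : MeasurableSpace E := borel E
  have : BorelSpace E := ⟨rfl⟩
  have : ProperSpace E := FiniteDimensional.proper ℂ E
  obtain ⟨δ, hδ, hball, M, hM⟩ : ∃ δ > 0, ball x₀ δ ⊆ U ∧ ∃ M, ∀ y ∈ ball x₀ δ, ‖F y‖ ≤ M := by
    obtain ⟨δ₁, h1, h2⟩ := Metric.isOpen_iff.1 hU x₀ hx₀
    have hc : ContinuousAt F x₀ := (hF.differentiableAt (hU.mem_nhds hx₀)).continuousAt
    obtain ⟨δ₂, h3, h4⟩ := Metric.continuousAt_iff.1 hc 1 one_pos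
    refine ⟨min δ₁ δ₂, lt_min h1 h3, (ball_subset_ball (min_le_left _ _)).trans h2, ‖F x₀‖ + 1,
      fun y hy => ?_⟩
    have := h4 (lt_of_lt_of_le (mem_ball.1 hy) (min_le_right _ _))
    rw [dist_eq_norm] at this
    linarith [norm_le_norm_add_norm_sub' (F y) (F x₀)]
  have hdU : ∀ y ∈ U, DifferentiableAt ℂ F y := fun y hy => hF.differentiableAt (hU.mem_nhds hy)
  -- With this radius the circle around any point of the ball of radius `δ / 4` stays in the ball of
  -- radius `δ / 2`, leaving a margin `δ / 2` for the estimate of `fderiv`.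
  set r : ℝ := δ / (4 * (‖v‖ + 1)) with hr
  have hr0 : 0 < r := by positivity
  have hrv : r * ‖v‖ ≤ δ / 4 := by
    rw [hr, div_mul_eq_mul_div, div_le_div_iff₀ (by positivity) (by norm_num)]
    nlinarith [norm_nonneg v]
  have hin : ∀ x ∈ ball x₀ (δ / 4), ∀ s : ℂ, ‖s‖ ≤ r → x + s • v ∈ ball x₀ (δ / 2) := by
    intro x hx s hs
    rw [mem_ball, dist_eq_norm] at hx ⊢
    calc ‖x + s • v - x₀‖ = ‖(x - x₀) + s • v‖ := by congr 1; abel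
      _ ≤ ‖x - x₀‖ + ‖s‖ * ‖v‖ := (norm_add_le _ _).trans (by rw [norm_smul])
      _ < δ / 2 := by nlinarith [norm_nonneg v, mul_le_mul_of_nonneg_right hs (norm_nonneg v)]
  have hin2 : ∀ y ∈ ball x₀ (δ / 2), ball y (δ / 2) ⊆ ball x₀ δ := fun y hy =>
    ball_subset_ball' (by rw [mem_ball] at hy; linarith)
  have hin3 : ball x₀ (δ / 2) ⊆ ball x₀ δ := ball_subset_ball (by linarith)
  have key : ∀ x ∈ ball x₀ (δ / 4), fderiv ℂ F x v =
      (2 * Real.pi * Complex.I : ℂ)⁻¹ • ∫ t in (0 : ℝ)..2 * Real.pi,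
        (deriv (circleMap 0 r) t * ((circleMap 0 r t - 0) ^ 2)⁻¹) * F (x + circleMap 0 r t • v) := by
    intro x hx
    have hd : ∀ s ∈ closedBall (0 : ℂ) r, DifferentiableAt ℂ (fun s : ℂ => F (x + s • v)) s := by
      intro s hs
      rw [mem_closedBall_zero_iff] at hs
      exact (hdU _ (hball (hin3 (hin x hx s hs)))).comp s
        (f := fun s : ℂ => x + s • v) (by fun_prop)
    have h1 : deriv (fun s : ℂ => F (x + s • v)) 0 = fderiv ℂ F x v := by
      have := DifferentiableAt.deriv_comp_add_smul (𝕜 := ℂ) (f := F) (x := x) (y := v) (t := 0)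
        (by simpa using hdU x (hball (ball_subset_ball (by linarith) hx)))
      simpa using this
    rw [← h1, ← Complex.two_pi_I_inv_smul_circleIntegral_sub_sq_inv_smul_of_differentiable
      (U := ball 0 (δ / (2 * (‖v‖ + 1)))) isOpen_ball (c := (0 : ℂ)) (R := r) (w₀ := 0)
      (closedBall_subset_ball ?_) ?_ (mem_ball_self hr0)]
    · simp only [circleIntegral, smul_eq_mul, mul_assoc]
    · rw [hr]
      exact div_lt_div_of_pos_left hδ (by positivity) (by linarith [norm_nonneg v])
    · intro s hs
      rw [mem_ball_zero_iff] at hs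
      refine DifferentiableAt.differentiableWithinAt ?_
      refine (hdU _ (hball ?_)).comp s (f := fun s : ℂ => x + s • v) (by fun_prop)
      rw [mem_ball, dist_eq_norm] at hx ⊢
      have : ‖s‖ * ‖v‖ ≤ δ / 2 := by
        calc ‖s‖ * ‖v‖ ≤ δ / (2 * (‖v‖ + 1)) * ‖v‖ := by gcongr
          _ ≤ δ / 2 := by
            rw [div_mul_eq_mul_div, div_le_div_iff₀ (by positivity) (by norm_num)]
            nlinarith [norm_nonneg v]
      calc ‖x + s • v - x₀‖ = ‖(x - x₀) + s • v‖ := by congr 1; abel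
        _ ≤ ‖x - x₀‖ + ‖s‖ * ‖v‖ := (norm_add_le _ _).trans (by rw [norm_smul])
        _ < δ := by linarith
  have hev : (fun x => fderiv ℂ F x v) =ᶠ[𝓝 x₀] fun x =>
      (2 * Real.pi * Complex.I : ℂ)⁻¹ • ∫ t in (0 : ℝ)..2 * Real.pi,
        (deriv (circleMap 0 r) t * ((circleMap 0 r t - 0) ^ 2)⁻¹) * F (x + circleMap 0 r t • v) :=
    Filter.eventually_of_mem (ball_mem_nhds x₀ (by positivity)) key
  refine DifferentiableAt.congr_of_eventuallyEq ?_ hev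
  set g : ℝ → ℂ := fun t => deriv (circleMap 0 r) t * ((circleMap 0 r t - 0) ^ 2)⁻¹ with hg
  have hgc : Continuous g := by
    simp only [hg, deriv_circleMap, sub_zero]
    refine Continuous.mul (by fun_prop) (Continuous.inv₀ (by fun_prop) fun t => ?_)
    exact pow_ne_zero _ (circleMap_ne_center hr0.ne')
  have hcn : ∀ t, ‖circleMap 0 r t‖ ≤ r := fun t => by simp [abs_of_pos hr0]
  have hcont : ∀ x ∈ ball x₀ (δ / 4), Continuous fun t : ℝ => F (x + circleMap 0 r t • v) := by
    intro x hx
    rw [continuous_iff_continuousAt]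
    intro t
    exact ContinuousAt.comp (f := fun t : ℝ => x + circleMap 0 r t • v)
      (hdU _ (hball (hin3 (hin x hx _ (hcn t))))).continuousAt (by fun_prop)
  have hfb : ∀ x ∈ ball x₀ (δ / 4), ∀ t,
      ‖fderiv ℂ F (x + circleMap 0 r t • v)‖ ≤ 2 * M / (δ / 2) := fun x hx t => by
    have h := hin x hx _ (hcn t)
    exact fderiv_norm_le_of_ball (by positivity)
      (fun y hy => (hdU y (hball (hin2 _ h hy))).differentiableWithinAt)
      (fun y hy => hM y (hin2 _ h hy))
  refine DifferentiableAt.const_smul (R := ℂ) (HasFDerivAt.differentiableAt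
    (intervalIntegral.hasFDerivAt_integral_of_dominated_of_fderiv_le (𝕜 := ℂ)
    (F := fun x t => g t * F (x + circleMap 0 r t • v))
    (F' := fun x t => g t • fderiv ℂ F (x + circleMap 0 r t • v))
    (bound := fun t => ‖g t‖ * (2 * M / (δ / 2)))
    (ball_mem_nhds x₀ (ε := δ / 4) (by positivity)) ?_ ?_ ?_ ?_ ?_ ?_)) _
  · refine Filter.eventually_of_mem (ball_mem_nhds x₀ (ε := δ / 4) (by positivity)) fun x hx => ?_
    exact (hgc.mul (hcont x hx)).aestronglyMeasurable
  · exact (hgc.mul (hcont x₀ (mem_ball_self (by positivity)))).intervalIntegrable _ _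
  · refine hgc.aestronglyMeasurable.smul ?_
    have h1 : Measurable fun t : ℝ => fderiv ℂ F (x₀ + circleMap 0 r t • v) :=
      (measurable_fderiv ℂ F).comp (Continuous.measurable (by fun_prop))
    exact h1.aestronglyMeasurable
  · refine Filter.Eventually.of_forall fun t _ x hx => ?_
    rw [norm_smul]
    exact mul_le_mul_of_nonneg_left (hfb x hx t) (norm_nonneg _)
  · exact (hgc.norm.mul continuous_const).intervalIntegrable _ _
  · refine Filter.Eventually.of_forall fun t _ x hx => ?_
    have h1 : HasFDerivAt F (fderiv ℂ F (x + circleMap 0 r t • v)) (x + circleMap 0 r t • v) :=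
      (hdU _ (hball (hin3 (hin x hx _ (hcn t))))).hasFDerivAt
    have h2 := h1.comp x (f := fun x => x + circleMap 0 r t • v)
      ((hasFDerivAt_id x).add_const (circleMap 0 r t • v))
    simpa using h2.const_mul (g t)

lemma differentiable_fderiv_apply [FiniteDimensional ℂ E] {F : E → ℂ} (hF : Differentiable ℂ F)
    (v : E) : Differentiable ℂ fun x => fderiv ℂ F x v :=
  differentiableOn_univ.1 (differentiableOn_fderiv_apply isOpen_univ hF.differentiableOn v)

lemma contDiff_of_differentiable [FiniteDimensional ℂ E] (n : ℕ) :
    ∀ {F : E → ℂ}, Differentiable ℂ F → ContDiff ℂ n F := by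
  induction n with
  | zero => exact fun hF => contDiff_zero.2 hF.continuous
  | succ n ih =>
    intro F hF
    have := (contDiff_succ_iff_fderiv_apply (𝕜 := ℂ) (n := n) (f := F)).2
      ⟨hF, by simp, fun y => ih (differentiable_fderiv_apply hF y)⟩
    exact_mod_cast this

end SeveralVariables

section SeveralVariables

open Metric Filter Topology Asymptotics

variable {E : Type*} [NormedAddCommGroup E] [NormedSpace ℂ E]

lemma iteratedDeriv_comp_smul [FiniteDimensional ℂ E] {F : E → ℂ} (hF : Differentiable ℂ F)
    (y : E) (d : ℕ) : iteratedDeriv d (fun s : ℂ => F (s • y)) =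
      fun s => iteratedFDeriv ℂ d F (s • y) fun _ => y := by
  induction d with
  | zero => ext s; simp
  | succ d ih =>
    ext s
    rw [iteratedDeriv_succ, ih]
    have h := ContDiffAt.deriv_fderiv_add_smul (𝕜 := ℂ) (f := F) (x := 0) (y := y) (t := s) (n := d)
      (by exact_mod_cast (contDiff_of_differentiable (d + 1) hF).contDiffAt)
    simpa using h

/-- On the line through `y`, Cauchy estimates on the circle of radius `1 / ‖y‖` bound the term of
degree `d` by `M ‖y‖ ^ d`. The tail is geometric with ratio at most `1 / 2`. -/
lemma norm_sub_taylor_le [FiniteDimensional ℂ E] {F : E → ℂ} (hF : Differentiable ℂ F) (T : ℕ)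
    {M : ℝ} (hM : ∀ y, ‖y‖ ≤ 1 → ‖F y‖ ≤ M) {y : E} (hy : ‖y‖ ≤ 1 / 2) (hy0 : y ≠ 0) :
    ‖F y - ∑ d ∈ Finset.range T, ((d.factorial : ℂ))⁻¹ * iteratedFDeriv ℂ d F 0 fun _ => y‖
      ≤ 2 * M * ‖y‖ ^ T := by
  have hyp : 0 < ‖y‖ := norm_pos_iff.2 hy0
  have hh : Differentiable ℂ fun s : ℂ => F (s • y) := hF.comp (by fun_prop)
  have hs := Complex.hasSum_taylorSeries_of_entire hh 0 1
  simp only [sub_zero, one_pow, one_smul, smul_eq_mul, iteratedDeriv_comp_smul hF, zero_smul, one_mul] at hs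
  have hb : ∀ d, ‖((d.factorial : ℂ))⁻¹ * iteratedFDeriv ℂ d F 0 fun _ => y‖ ≤ M * ‖y‖ ^ d := by
    intro d
    have := Complex.norm_iteratedDeriv_le_of_forall_mem_sphere_norm_le (c := 0) (R := 1 / ‖y‖)
      (C := M) d (by positivity) hh.diffContOnCl fun s hs => by
        refine hM _ ?_
        rw [mem_sphere_zero_iff_norm] at hs
        rw [norm_smul, hs, one_div, inv_mul_cancel₀ hyp.ne']
    simp only [iteratedDeriv_comp_smul hF, zero_smul] at this
    rw [norm_mul, norm_inv, RCLike.norm_natCast, inv_mul_le_iff₀ (by positivity)]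
    refine this.trans (le_of_eq ?_)
    rw [one_div, inv_pow, div_inv_eq_mul, mul_assoc]
  have h2 := (hasSum_nat_add_iff' T).2 hs
  have hg : HasSum (fun d : ℕ => M * ‖y‖ ^ T * ‖y‖ ^ d) (M * ‖y‖ ^ T * (1 - ‖y‖)⁻¹) :=
    (hasSum_geometric_of_lt_one hyp.le (by linarith)).mul_left _
  rw [← h2.tsum_eq]
  refine (tsum_of_norm_bounded hg fun d => (hb _).trans (le_of_eq (by rw [pow_add]; ring))).trans ?_
  have hM0 : 0 ≤ M := (norm_nonneg _).trans (hM 0 (by simp))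
  have : (1 - ‖y‖)⁻¹ ≤ 2 := by
    rw [inv_le_comm₀ (by linarith) two_pos]; linarith
  nlinarith [mul_nonneg hM0 (pow_nonneg hyp.le T)]

/-- Each exponent, rather than the total degree, is bounded by `T`; this box is larger than
necessary but has exactly `T ^ n` elements, which is all that the later count needs. -/
lemma multilinear_mem_span_monomial {n d T : ℕ} (hd : d < T)
    (p : ContinuousMultilinearMap ℂ (fun _ : Fin d => Fin n → ℂ) ℂ) :
    (fun y => p fun _ => y) ∈ Submodule.span ℂ (Set.range fun β : Fin n → Fin T =>
      fun y : Fin n → ℂ => ∏ i, y i ^ (β i : ℕ)) := by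
  have h : (fun y : Fin n → ℂ => p fun _ => y) = ∑ r : Fin d → Fin n,
      (p fun k => Pi.single (r k) (1 : ℂ)) • fun y : Fin n → ℂ => ∏ k, y (r k) := by
    ext y
    have h1 : (fun _ : Fin d => y) = fun _ => ∑ j, y j • Pi.single j (1 : ℂ) := by
      ext k i
      simp [Finset.sum_apply, Pi.single_apply]
    rw [h1, ContinuousMultilinearMap.map_sum, Finset.sum_apply]
    refine Finset.sum_congr rfl fun r _ => ?_
    rw [ContinuousMultilinearMap.map_smul_univ]
    simp [mul_comm]
  rw [h]
  refine Submodule.sum_mem _ fun r _ => Submodule.smul_mem _ _ (Submodule.subset_span ?_)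
  refine ⟨fun i => ⟨(Finset.univ.filter fun k => r k = i).card,
    lt_of_le_of_lt (Finset.card_le_univ _) (by simpa using hd)⟩, ?_⟩
  ext y
  rw [← Finset.prod_fiberwise Finset.univ r]
  refine Finset.prod_congr rfl fun i _ => ?_
  rw [Finset.prod_congr rfl (g := fun _ => y i) fun k hk => by rw [(Finset.mem_filter.1 hk).2],
    Finset.prod_const]

lemma exists_taylor_monomial {n : ℕ} (T : ℕ) {F : (Fin n → ℂ) → ℂ} (hF : Differentiable ℂ F) :
    ∃ c : (Fin n → Fin T) → ℂ,
      (fun y => F y - ∑ β, c β * ∏ i, y i ^ (β i : ℕ)) =O[𝓝 0] fun y => ‖y‖ ^ T := by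
  have hmem : (fun y => ∑ d ∈ Finset.range T,
      ((d.factorial : ℂ))⁻¹ * iteratedFDeriv ℂ d F 0 fun _ => y) ∈
      Submodule.span ℂ (Set.range fun β : Fin n → Fin T =>
        fun y : Fin n → ℂ => ∏ i, y i ^ (β i : ℕ)) := by
    have : (fun y => ∑ d ∈ Finset.range T,
      ((d.factorial : ℂ))⁻¹ * iteratedFDeriv ℂ d F 0 fun _ => y) = ∑ d ∈ Finset.range T,
        ((d.factorial : ℂ))⁻¹ • fun y => iteratedFDeriv ℂ d F 0 fun _ => y := by
      ext y; simp [Finset.sum_apply]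
    rw [this]
    exact Submodule.sum_mem _ fun d hd => Submodule.smul_mem _ _
      (multilinear_mem_span_monomial (Finset.mem_range.1 hd) _)
  obtain ⟨c, hc⟩ := (Submodule.mem_span_range_iff_exists_fun ℂ).1 hmem
  refine ⟨c, ?_⟩
  obtain ⟨M, hM⟩ := (isCompact_closedBall (0 : Fin n → ℂ) 1).exists_bound_of_continuousOn
    hF.continuous.continuousOn
  have hM' : ∀ y, ‖y‖ ≤ 1 → ‖F y‖ ≤ M := fun y hy => hM y (by simpa using hy)
  have key : ∀ y : Fin n → ℂ, F y - ∑ β, c β * ∏ i, y i ^ (β i : ℕ) =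
      F y - ∑ d ∈ Finset.range T, ((d.factorial : ℂ))⁻¹ * iteratedFDeriv ℂ d F 0 fun _ => y := by
    intro y
    have := congrFun hc y
    simp only [Finset.sum_apply, Pi.smul_apply, smul_eq_mul] at this
    rw [this]
  refine IsBigO.of_bound (2 * M) (Filter.eventually_of_mem
    (closedBall_mem_nhds (0 : Fin n → ℂ) (ε := 1 / 2) (by norm_num)) fun y hy => ?_)
  rw [mem_closedBall_zero_iff] at hy
  rw [key, norm_pow, norm_norm]
  have hM0 : 0 ≤ M := (norm_nonneg _).trans (hM' 0 (by simp))
  rcases eq_or_ne y 0 with rfl | hy0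
  · rcases T with _ | T
    · simpa using (hM' 0 (by simp)).trans (by linarith)
    · rw [Finset.sum_range_succ']
      rw [Finset.sum_eq_zero fun d _ => by
        rw [ContinuousMultilinearMap.map_coord_zero _ 0 rfl, mul_zero]]
      simp
  · exact norm_sub_taylor_le hF T hM' hy hy0

/-- Vanishing to order `T` at the origin amounts to at most `T ^ n` linear conditions on entire
functions of `n` variables. -/
lemma exists_combination_isBigO {n : ℕ} (T : ℕ) {I : Type*} [Fintype I]
    (hI : T ^ n < Fintype.card I) {g : I → (Fin n → ℂ) → ℂ} (hg : ∀ i, Differentiable ℂ (g i)) :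
    ∃ c : I → ℂ, c ≠ 0 ∧ (fun y => ∑ i, c i * g i y) =O[𝓝 0] fun y => ‖y‖ ^ T := by
  choose Q hQ using fun i => exists_taylor_monomial T (hg i)
  let Φ : (I → ℂ) →ₗ[ℂ] ((Fin n → Fin T) → ℂ) := Fintype.linearCombination ℂ Q
  have hlt : Module.finrank ℂ ((Fin n → Fin T) → ℂ) < Module.finrank ℂ (I → ℂ) := by
    simpa using hI
  obtain ⟨c, hc, hc0⟩ := (Submodule.ne_bot_iff _).1 (LinearMap.ker_ne_bot_of_finrank_lt (f := Φ) hlt)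
  refine ⟨c, hc0, ?_⟩
  have h0 : ∀ β, ∑ i, c i * Q i β = 0 := fun β => by
    have := congrFun (LinearMap.mem_ker.1 hc) β
    simpa [Φ, Fintype.linearCombination_apply, Finset.sum_apply] using this
  have hsum : (fun y => ∑ i, c i * (g i y - ∑ β, Q i β * ∏ k, y k ^ (β k : ℕ)))
      =O[𝓝 0] fun y : Fin n → ℂ => ‖y‖ ^ T :=
    IsBigO.fun_sum fun i _ => (hQ i).const_mul_left _
  refine hsum.congr_left fun y => ?_
  simp only [mul_sub, Finset.sum_sub_distrib, Finset.mul_sum]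
  rw [Finset.sum_comm, sub_eq_self]
  refine Finset.sum_eq_zero fun β _ => ?_
  simp only [← mul_assoc]
  rw [← Finset.sum_mul, h0, zero_mul]

/-- A solution of a first order equation `D F = a F`, `D` a vector field which does not vanish at
the origin, vanishes there to the order to which it vanishes along a transversal slice. -/
lemma isBigO_of_slice {n : ℕ} {F a : E → ℂ} {u : E → E} (hF : Differentiable ℂ F)
    (ha : ContinuousAt a 0) (hu : DifferentiableAt ℂ u 0)
    (hD : ∀ x, fderiv ℂ F x (u x) = a x * F x)
    (ι : (Fin n → ℂ) →L[ℂ] E) (π : E →L[ℂ] (Fin n → ℂ)) (lam : E →L[ℂ] ℂ)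
    (hdec : ∀ x, ι (π x) + lam x • u 0 = x) {T : ℕ}
    (hT : (fun y => F (ι y)) =O[𝓝 0] fun y => ‖y‖ ^ T) :
    F =O[𝓝 0] fun x => ‖x‖ ^ T := by
  -- The order of vanishing is raised one unit at a time: order `t` of `F` gives order `t` of its
  -- derivative along `u 0`, and integration from the slice gives order `t + 1`.
  suffices h : ∀ t ≤ T, F =O[𝓝 0] fun x => ‖x‖ ^ t from h T le_rfl
  intro t
  induction t with
  | zero =>
    intro _
    simp only [pow_zero]
    exact hF.continuous.continuousAt.isBigO_one ℝ
  | succ t ih =>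
    intro ht
    set v := u 0 with hv
    obtain ⟨C₁, hC₁, h1⟩ := (ih (by omega)).exists_pos
    obtain ⟨C₂, hC₂, h2⟩ := (ha.isBigO_one ℝ).exists_pos
    obtain ⟨C₃, hC₃, h3⟩ := hu.isBigO_sub.exists_pos
    obtain ⟨C₄, hC₄, h4⟩ := hT.exists_pos
    obtain ⟨δ, hδ, hb⟩ := Metric.eventually_nhds_iff_ball.1
      (h1.bound.and (h2.bound.and h3.bound))
    obtain ⟨δ', hδ', hb'⟩ := Metric.eventually_nhds_iff_ball.1 h4.bound
    set K := C₂ * C₁ + 2 * (C₁ * 2 ^ t) * C₃ with hK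
    -- The Cauchy estimate on the ball of radius `‖x‖`, multiplied through by `‖x‖` so that the
    -- exponent `t - 1` never occurs.
    have hfd : ∀ x, ‖x‖ < δ / 2 → ‖fderiv ℂ F x‖ * ‖x‖ ≤ 2 * (C₁ * 2 ^ t) * ‖x‖ ^ t := by
      intro x hx
      rcases eq_or_ne x 0 with rfl | hx0
      · simp only [norm_zero, mul_zero]; positivity
      have hxp : 0 < ‖x‖ := norm_pos_iff.2 hx0
      have h := fderiv_norm_le_of_ball (F := F) (x := x) (r := ‖x‖) (M := C₁ * (2 * ‖x‖) ^ t) hxp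
        hF.differentiableOn fun y hy => by
          have hy1 : ‖y‖ ≤ 2 * ‖x‖ := by
            rw [mem_ball, dist_eq_norm] at hy
            linarith [norm_le_norm_add_norm_sub' y x]
          have := (hb y (by rw [mem_ball_zero_iff]; linarith)).1
          rw [norm_pow, norm_norm] at this
          exact this.trans (by gcongr)
      calc _ ≤ 2 * (C₁ * (2 * ‖x‖) ^ t) / ‖x‖ * ‖x‖ := by gcongr
        _ = _ := by rw [div_mul_cancel₀ _ hxp.ne', mul_pow]; ring
    have hdv : ∀ x, ‖x‖ < δ / 2 → ‖fderiv ℂ F x v‖ ≤ K * ‖x‖ ^ t := by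
      intro x hx
      obtain ⟨b1, b2, b3⟩ := hb x (by rw [mem_ball_zero_iff]; linarith)
      rw [norm_pow, norm_norm] at b1
      rw [norm_one, mul_one] at b2
      rw [sub_zero] at b3
      -- The error from freezing `u` at the origin is harmless: `u x - v` is `O(‖x‖)`, which makes
      -- up for the order lost in `fderiv`.
      have e : fderiv ℂ F x v = a x * F x - fderiv ℂ F x (u x - v) := by
        rw [map_sub, hD]; ring
      rw [e]
      calc _ ≤ ‖a x * F x‖ + ‖fderiv ℂ F x (u x - v)‖ := norm_sub_le _ _
        _ ≤ C₂ * (C₁ * ‖x‖ ^ t) + ‖fderiv ℂ F x‖ * (C₃ * ‖x‖) := by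
          rw [norm_mul]
          refine add_le_add (by gcongr) ?_
          exact (ContinuousLinearMap.le_opNorm _ _).trans (by gcongr)
        _ ≤ C₂ * (C₁ * ‖x‖ ^ t) + C₃ * (2 * (C₁ * 2 ^ t) * ‖x‖ ^ t) := by
          have := hfd x hx
          nlinarith
        _ = K * ‖x‖ ^ t := by rw [hK]; ring
    have hK0 : 0 ≤ K := by positivity
    set A := ‖ι‖ * ‖π‖ + ‖lam‖ * ‖v‖ + ‖π‖ + ‖lam‖ + 1 with hA
    have hA1 : 1 ≤ A := by
      have : 0 ≤ ‖ι‖ * ‖π‖ + ‖lam‖ * ‖v‖ + ‖π‖ + ‖lam‖ := by positivity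
      linarith
    refine IsBigO.of_bound (C₄ * A ^ T + K * A ^ t * A) ?_
    set ε := min (min (δ / 2 / A) (δ' / A)) 1 with hε
    have hε0 : 0 < ε := by positivity
    refine Filter.eventually_of_mem (ball_mem_nhds (0 : E) hε0) fun x hx => ?_
    rw [mem_ball_zero_iff] at hx
    have hx1 : A * ‖x‖ < δ / 2 := by
      rw [mul_comm, ← lt_div_iff₀ (by positivity)]
      exact hx.trans_le ((min_le_left _ _).trans (min_le_left _ _))
    have hx2 : A * ‖x‖ < δ' := by
      rw [mul_comm, ← lt_div_iff₀ (by positivity)]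
      exact hx.trans_le ((min_le_left _ _).trans (min_le_right _ _))
    have hx3 : ‖x‖ ≤ 1 := (hx.trans_le (min_le_right _ _)).le
    have hπ : ‖π x‖ ≤ A * ‖x‖ := (π.le_opNorm x).trans (by
      gcongr
      have : 0 ≤ ‖ι‖ * ‖π‖ + ‖lam‖ * ‖v‖ + ‖lam‖ := by positivity
      linarith)
    have hlam : ‖lam x‖ ≤ A * ‖x‖ := (lam.le_opNorm x).trans (by
      gcongr
      have : 0 ≤ ‖ι‖ * ‖π‖ + ‖lam‖ * ‖v‖ + ‖π‖ := by positivity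
      linarith)
    have hpath : ∀ s : ℂ, ‖s‖ ≤ 1 → ‖ι (π x) + (s * lam x) • v‖ ≤ A * ‖x‖ := by
      intro s hs
      calc _ ≤ ‖ι (π x)‖ + ‖(s * lam x) • v‖ := norm_add_le _ _
        _ ≤ ‖ι‖ * (‖π‖ * ‖x‖) + 1 * (‖lam‖ * ‖x‖) * ‖v‖ := by
          rw [norm_smul, norm_mul]
          gcongr
          · exact (ι.le_opNorm _).trans (by gcongr; exact π.le_opNorm _)
          · exact lam.le_opNorm _
        _ = (‖ι‖ * ‖π‖ + ‖lam‖ * ‖v‖) * ‖x‖ := by ring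
        _ ≤ A * ‖x‖ := by
          gcongr
          have : 0 ≤ ‖π‖ + ‖lam‖ := by positivity
          linarith
    -- Mean value inequality along the segment from the projection of `x` on the slice to `x`, which
    -- has direction `v`.
    have hmv : ‖F x - F (ι (π x))‖ ≤ K * (A * ‖x‖) ^ t * (A * ‖x‖) := by
      have hder : ∀ s ∈ closedBall (0 : ℂ) 1,
          HasDerivWithinAt (fun s : ℂ => F (ι (π x) + (s * lam x) • v))
            (fderiv ℂ F (ι (π x) + (s * lam x) • v) (lam x • v)) (closedBall 0 1) s := by
        intro s _
        have h5 : HasDerivAt (fun s : ℂ => ι (π x) + (s * lam x) • v) (lam x • v) s := by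
          have := (((hasDerivAt_id s).mul_const (lam x)).smul_const v).const_add (ι (π x))
          simpa using this
        exact (HasFDerivAt.comp_hasDerivAt s (hF _).hasFDerivAt h5).hasDerivWithinAt
      have := (convex_closedBall (0 : ℂ) 1).norm_image_sub_le_of_norm_hasDerivWithin_le
        (C := K * (A * ‖x‖) ^ t * (A * ‖x‖)) hder (fun s hs => by
          rw [mem_closedBall_zero_iff] at hs
          rw [map_smul, norm_smul, mul_comm]
          have h6 := hdv _ ((hpath s hs).trans_lt hx1)
          refine mul_le_mul (h6.trans ?_) hlam (norm_nonneg _) (by positivity)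
          gcongr
          exact hpath s hs) (x := 0) (y := 1) (by simp) (by simp)
      simpa [hdec] using this
    have hsl : ‖F (ι (π x))‖ ≤ C₄ * (A * ‖x‖) ^ T := by
      have := hb' (π x) (by rw [mem_ball_zero_iff]; exact hπ.trans_lt hx2)
      rw [norm_pow, norm_norm] at this
      exact this.trans (by gcongr)
    have hpow : ‖x‖ ^ T ≤ ‖x‖ ^ (t + 1) := pow_le_pow_of_le_one (norm_nonneg _) hx3 ht
    rw [norm_pow, norm_norm]
    calc ‖F x‖ ≤ ‖F (ι (π x))‖ + ‖F x - F (ι (π x))‖ := norm_le_norm_add_norm_sub' _ _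
      _ ≤ C₄ * (A * ‖x‖) ^ T + K * (A * ‖x‖) ^ t * (A * ‖x‖) := add_le_add hsl hmv
      _ = C₄ * A ^ T * ‖x‖ ^ T + K * A ^ t * A * ‖x‖ ^ (t + 1) := by
        rw [mul_pow, mul_pow, pow_succ]; ring
      _ ≤ C₄ * A ^ T * ‖x‖ ^ (t + 1) + K * A ^ t * A * ‖x‖ ^ (t + 1) := by gcongr
      _ = _ := by ring

end SeveralVariables

/-! ### Entire functions form a domain; a Schwarz lemma under growth control; monomials of a common
index. -/

section SeveralVariables

open Metric Filter Topology Asymptotics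

variable {E : Type*} [NormedAddCommGroup E] [NormedSpace ℂ E]

/-- If `F p ≠ 0` and `G q ≠ 0`, restriction to the complex line through `p` and `q` contradicts the
identity theorem in one variable; convexity keeps the parameter set connected. -/
lemma eq_zero_or_eq_zero_of_mul_eqOn_zero {U : Set E} (hU : IsOpen U) (hc : Convex ℝ U)
    {F G : E → ℂ} (hF : DifferentiableOn ℂ F U) (hG : DifferentiableOn ℂ G U)
    (h : ∀ x ∈ U, F x * G x = 0) : (∀ x ∈ U, F x = 0) ∨ ∀ x ∈ U, G x = 0 := by
  by_contra! hcon
  obtain ⟨⟨p, hp, hFp⟩, q, hq, hGq⟩ := hcon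
  set ψ : ℂ → E := fun s => p + s • (q - p) with hψ
  have hψd : Differentiable ℂ ψ := by fun_prop
  set V : Set ℂ := ψ ⁻¹' U with hV
  have hVo : IsOpen V := hU.preimage hψd.continuous
  have hVc : Convex ℝ V := by
    intro s hs t ht a b ha hb hab
    have : ψ (a • s + b • t) = a • ψ s + b • ψ t := by
      simp only [hψ, smul_add]
      rw [add_smul, smul_assoc, smul_assoc]
      calc p + (a • s • (q - p) + b • t • (q - p))
          = (a • p + b • p) + (a • s • (q - p) + b • t • (q - p)) := by
            rw [← add_smul, hab, one_smul]
        _ = _ := by abel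
    rw [hV, Set.mem_preimage, this]
    exact hc hs ht ha hb hab
  have hFa : AnalyticOnNhd ℂ (F ∘ ψ) V :=
    (hF.comp hψd.differentiableOn fun s hs => hs).analyticOnNhd hVo
  have hGa : AnalyticOnNhd ℂ (G ∘ ψ) V :=
    (hG.comp hψd.differentiableOn fun s hs => hs).analyticOnNhd hVo
  have h0 : (0 : ℂ) ∈ V := by simpa [hV, hψ] using hp
  have h1 : (1 : ℂ) ∈ V := by simpa [hV, hψ] using hq
  rcases hFa.eq_zero_or_eq_zero_of_mul_eq_zero hGa (fun s hs => h _ hs) hVc.isPreconnected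
    with h2 | h2
  · exact hFp (by simpa [hψ] using h2 0 h0)
  · exact hGq (by simpa [hψ] using h2 1 h1)

variable (E) in
/-- The ring of entire functions. -/
def entireRing : Subring (E → ℂ) where
  carrier := {F | Differentiable ℂ F}
  mul_mem' := fun hF hG => Differentiable.mul hF hG
  one_mem' := differentiable_const _
  add_mem' := fun hF hG => Differentiable.add hF hG
  zero_mem' := differentiable_const _
  neg_mem' := fun hF => Differentiable.neg hF

instance : IsDomain (entireRing E) := by
  have : NoZeroDivisors (entireRing E) := ⟨by
    rintro ⟨F, hF⟩ ⟨G, hG⟩ h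
    have h' : ∀ x, F x * G x = 0 := fun x => congrFun (congrArg Subtype.val h) x
    refine (eq_zero_or_eq_zero_of_mul_eqOn_zero isOpen_univ convex_univ
      (Differentiable.differentiableOn hF) (Differentiable.differentiableOn hG)
      fun x _ => h' x).imp (fun h => ?_) fun h => ?_
    · exact Subtype.ext (funext fun x => h x trivial)
    · exact Subtype.ext (funext fun x => h x trivial)⟩
  exact NoZeroDivisors.to_isDomain _

/-- An entire function whose growth is controlled by its values on a ball vanishes identically if
it vanishes at some point to a high order. -/
lemma eq_zero_of_isBigO_pow [ProperSpace E] {F : E → ℂ} (hF : Differentiable ℂ F) {ρ B : ℝ}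
    (hρ : 0 ≤ ρ) (z₀ : E) {T : ℕ} (hT : T ≠ 0) (hB : B < 3 ^ T)
    (hg : ∀ z, ‖z‖ ≤ 4 * (ρ + ‖z₀‖ + 1) → ∃ w, ‖w‖ ≤ ρ ∧ ‖F z‖ ≤ B * ‖F w‖)
    (hO : (fun x => F (z₀ + x)) =O[𝓝 0] fun x => ‖x‖ ^ T) : ∀ z, ‖z‖ ≤ ρ → F z = 0 := by
  -- The ball of radius `r` about `z₀` contains the ball of radius `ρ` about 0, and the ball of
  -- radius `3r` about `z₀` lies in the region where growth is controlled.
  set r := ρ + ‖z₀‖ + 1 with hr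
  have hr0 : 0 < r := by positivity
  obtain ⟨w, hw, hmax⟩ := (isCompact_closedBall z₀ r).exists_isMaxOn
    ⟨z₀, mem_closedBall_self hr0.le⟩ hF.continuous.norm.continuousOn
  have hmax' : ∀ z ∈ closedBall z₀ r, ‖F z‖ ≤ ‖F w‖ := fun z hz => hmax hz
  have hsub : ∀ z, ‖z‖ ≤ ρ → z ∈ closedBall z₀ r := fun z hz => by
    rw [mem_closedBall, dist_eq_norm]
    linarith [norm_sub_le z z₀]
  have hw0 : ‖F w‖ = 0 := by
    by_contra hne
    have hpos : 0 < ‖F w‖ := lt_of_le_of_ne (norm_nonneg _) (Ne.symm hne)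
    have hO' : F =O[𝓝 z₀] fun x => ‖x - z₀‖ ^ T := by
      have : Tendsto (fun x => x - z₀) (𝓝 z₀) (𝓝 0) := by
        have : Continuous fun x : E => x - z₀ := by fun_prop
        simpa using this.tendsto z₀
      simpa [Function.comp_def] using hO.comp_tendsto this
    have hz0 : F z₀ = 0 := by
      have := hO.eq_zero_imp.self_of_nhds
      simpa [hT] using this
    obtain ⟨n, rfl⟩ := Nat.exists_eq_succ_of_ne_zero hT
    have hB0 : 0 ≤ B := by
      by_contra hneg
      obtain ⟨w', -, hw'⟩ := hg w (by
        rw [mem_closedBall, dist_eq_norm] at hw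
        linarith [norm_le_norm_add_norm_sub' w z₀, norm_nonneg z₀])
      nlinarith [norm_nonneg (F w'), not_le.1 hneg]
    have hn : (F · - F z₀) =o[𝓝 z₀] fun x => ‖x - z₀‖ ^ n := by
      simp only [hz0, sub_zero]
      refine hO'.trans_isLittleO ?_
      have h1 : (fun x => ‖x - z₀‖) =o[𝓝 z₀] fun _ => (1 : ℝ) := by
        rw [isLittleO_one_iff]
        have : Continuous fun x : E => ‖x - z₀‖ := by fun_prop
        simpa using this.tendsto z₀
      simpa [pow_succ] using (isBigO_refl (fun x => ‖x - z₀‖ ^ n) (𝓝 z₀)).mul_isLittleO h1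
    have hmaps : Set.MapsTo F (ball z₀ (3 * r)) (closedBall (F z₀) (B * ‖F w‖)) := by
      intro z hz
      rw [mem_ball, dist_eq_norm] at hz
      obtain ⟨w', hw', h2⟩ := hg z (by
        linarith [norm_le_norm_add_norm_sub' z z₀, norm_nonneg z₀])
      rw [hz0, mem_closedBall_zero_iff]
      exact h2.trans (by gcongr; exact hmax' _ (hsub _ hw'))
    -- Schwarz lemma with a zero of order `T` on the ball of radius `3r`: at the maximum point, `‖F
    -- w‖ ≤ B ‖F w‖ / 3 ^ T`, impossible for `F w ≠ 0`.
    have := Complex.dist_le_mul_div_pow_of_mapsTo_ball_of_isLittleO hF.differentiableOn hmaps hn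
      (z := w) (by rw [mem_ball]; rw [mem_closedBall] at hw; linarith)
    rw [hz0, dist_zero_right] at this
    have h3 : (dist w z₀ / (3 * r)) ^ (n + 1) ≤ (1 / 3) ^ (n + 1) := by
      refine pow_le_pow_left₀ (by positivity) ?_ _
      rw [div_le_div_iff₀ (by positivity) (by norm_num)]
      rw [mem_closedBall] at hw
      linarith
    have h4 : ‖F w‖ ≤ B * ‖F w‖ * (1 / 3) ^ (n + 1) := this.trans (by gcongr)
    have h5 : B * (1 / 3 : ℝ) ^ (n + 1) < 1 := by
      rw [one_div, inv_pow, ← div_eq_mul_inv, div_lt_one (by positivity)]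
      exact hB
    nlinarith
  intro z hz
  have := hmax' z (hsub z hz)
  rw [hw0] at this
  exact norm_le_zero_iff.1 this

end SeveralVariables

/-- A family of additive subgroups of functions with a compatible multiplication. -/
structure IsGradedPredicate {X : Type*} (P : ℕ → (X → ℂ) → Prop) : Prop where
  zero : ∀ N, P N 0
  one : P 0 1
  add : ∀ N f g, P N f → P N g → P N (f + g)
  smul : ∀ N (c : ℂ) f, P N f → P N (c • f)
  mul : ∀ N M f g, P N f → P M g → P (N + M) (f * g)

namespace IsGradedPredicate

variable {X : Type*} {P : ℕ → (X → ℂ) → Prop}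

lemma pow (hP : IsGradedPredicate P) {N : ℕ} {f : X → ℂ} (hf : P N f) (k : ℕ) :
    P (k * N) (f ^ k) := by
  induction k with
  | zero => simpa using hP.one
  | succ k ih =>
    rw [pow_succ, add_mul, one_mul]
    exact hP.mul _ _ _ _ ih hf

lemma prod_pow (hP : IsGradedPredicate P) {J : Type*} {m α : J → ℕ} {f : J → X → ℂ}
    (hf : ∀ j, P (m j) (f j)) (s : Finset J) :
    P (∑ j ∈ s, α j * m j) (∏ j ∈ s, f j ^ α j) := by
  classical
  induction s using Finset.induction_on with
  | empty => simpa using hP.one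
  | insert j s hj ih =>
    rw [Finset.sum_insert hj, Finset.prod_insert hj]
    exact hP.mul _ _ _ _ (hP.pow (hf j) _) ih

lemma sum (hP : IsGradedPredicate P) {N : ℕ} {I : Type*} {g : I → X → ℂ} (s : Finset I)
    (hg : ∀ i ∈ s, P N (g i)) : P N (∑ i ∈ s, g i) := by
  classical
  induction s using Finset.induction_on with
  | empty => simpa using hP.zero N
  | insert j s hj ih =>
    rw [Finset.sum_insert hj]
    exact hP.add _ _ _ (hg j (by simp)) (ih fun i hi => hg i (by simp [hi]))

lemma combination (hP : IsGradedPredicate P) {J I : Type*} [Fintype J] [Fintype I] {m : J → ℕ}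
    {α : I → J → ℕ} {f : J → X → ℂ} {N : ℕ} (hf : ∀ j, P (m j) (f j))
    (hα : ∀ i, ∑ j, α i j * m j = N) (c : I → ℂ) : P N (∑ i, c i • ∏ j, f j ^ α i j) :=
  hP.sum _ fun i _ => hP.smul _ _ _ (hα i ▸ hP.prod_pow hf _)

end IsGradedPredicate

/-- Exponents of monomials of the common index `(∏ j, m j) * (l * s)`. -/
def boxExponent {l : ℕ} (m : Fin (l + 1) → ℕ) (s : ℕ) (a : Fin l → Fin (s + 1)) :
    Fin (l + 1) → ℕ :=
  Fin.cons ((∏ j, m j) / m 0 * (l * s - ∑ i, (a i : ℕ)))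
    fun i => (∏ j, m j) / m i.succ * (a i : ℕ)

lemma sum_boxExponent {l : ℕ} (m : Fin (l + 1) → ℕ) (s : ℕ)
    (a : Fin l → Fin (s + 1)) : ∑ j, boxExponent m s a j * m j = (∏ j, m j) * (l * s) := by
  have hd : ∀ j, (∏ j, m j) / m j * m j = ∏ j, m j := fun j =>
    Nat.div_mul_cancel (Finset.dvd_prod_of_mem m (Finset.mem_univ j))
  have hle : ∑ i, (a i : ℕ) ≤ l * s := by
    calc ∑ i, (a i : ℕ) ≤ ∑ _i : Fin l, s := Finset.sum_le_sum fun i _ => by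
          have := (a i).2; omega
      _ = l * s := by simp
  rw [Fin.sum_univ_succ]
  simp only [boxExponent, Fin.cons_zero, Fin.cons_succ]
  have h1 : ∀ i : Fin l, (∏ j, m j) / m i.succ * (a i : ℕ) * m i.succ = (∏ j, m j) * a i :=
    fun i => by rw [mul_right_comm, hd]
  rw [Finset.sum_congr rfl fun i _ => h1 i, ← Finset.mul_sum, mul_right_comm, hd, ← mul_add,
    Nat.sub_add_cancel hle]

lemma boxExponent_injective {l : ℕ} {m : Fin (l + 1) → ℕ} (hm : ∀ j, m j ≠ 0) (s : ℕ) :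
    Function.Injective (boxExponent m s) := by
  intro a b hab
  ext i
  have h := congrFun hab i.succ
  simp only [boxExponent, Fin.cons_succ] at h
  refine Nat.eq_of_mul_eq_mul_left (Nat.div_pos ?_ (Nat.pos_of_ne_zero (hm _))) h
  exact Nat.le_of_dvd (Finset.prod_pos fun j _ => Nat.pos_of_ne_zero (hm j))
    (Finset.dvd_prod_of_mem m (Finset.mem_univ _))

/-! ### Vanishing Jacobian of entire functions: a first order operator, and a homogeneous relation.
-/

section SeveralVariables

open Metric Filter Topology Asymptotics

variable {n : ℕ}

lemma isGradedPredicate_eigen {E : Type*} [NormedAddCommGroup E] [NormedSpace ℂ E]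
    (U : E → E) (u₀ : E → ℂ) :
    IsGradedPredicate fun (N : ℕ) (f : E → ℂ) => Differentiable ℂ f ∧
      ∀ x, fderiv ℂ f x (U x) = -(N : ℂ) * u₀ x * f x where
  zero N := ⟨differentiable_const _, fun x => by simp [show (0 : E → ℂ) = fun _ => 0 from rfl]⟩
  one := ⟨differentiable_const _, fun x => by
    simp [show (1 : E → ℂ) = fun _ => 1 from rfl]⟩
  add N f g hf hg := ⟨hf.1.add hg.1, fun x => by
    rw [fderiv_add (hf.1 x) (hg.1 x), _root_.add_apply, hf.2, hg.2, Pi.add_apply]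
    ring⟩
  smul N c f hf := ⟨hf.1.const_smul c, fun x => by
    rw [fderiv_const_smul (hf.1 x), _root_.smul_apply, hf.2, Pi.smul_apply,
      smul_eq_mul, smul_eq_mul]
    ring⟩
  mul N M f g hf hg := ⟨hf.1.mul hg.1, fun x => by
    rw [fderiv_mul (hf.1 x) (hg.1 x), _root_.add_apply,
      _root_.smul_apply, _root_.smul_apply, hf.2, hg.2, Pi.mul_apply,
      smul_eq_mul, smul_eq_mul]
    push_cast
    ring⟩

/-- A splitting of `ℂ^(n+1)` into a coordinate hyperplane and a transversal line. -/
lemma exists_slice {v : Fin (n + 1) → ℂ} (hv : v ≠ 0) :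
    ∃ (ι : (Fin n → ℂ) →L[ℂ] (Fin (n + 1) → ℂ)) (π : (Fin (n + 1) → ℂ) →L[ℂ] (Fin n → ℂ))
      (lam : (Fin (n + 1) → ℂ) →L[ℂ] ℂ), ∀ x, ι (π x) + lam x • v = x := by
  obtain ⟨i, hi⟩ := Function.ne_iff.1 hv
  simp only [Pi.zero_apply] at hi
  let lam : (Fin (n + 1) → ℂ) →L[ℂ] ℂ := (v i)⁻¹ • ContinuousLinearMap.proj i
  let π : (Fin (n + 1) → ℂ) →L[ℂ] (Fin n → ℂ) := ContinuousLinearMap.pi fun k =>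
    ContinuousLinearMap.proj (i.succAbove k) - v (i.succAbove k) • lam
  let ι₀ : (Fin n → ℂ) →ₗ[ℂ] (Fin (n + 1) → ℂ) :=
    { toFun := fun y => i.insertNth (0 : ℂ) y
      map_add' := fun x y => by
        ext j; refine Fin.succAboveCases i ?_ (fun k => ?_) j <;> simp
      map_smul' := fun c x => by
        ext j; refine Fin.succAboveCases i ?_ (fun k => ?_) j <;> simp }
  refine ⟨LinearMap.toContinuousLinearMap ι₀, π, lam, fun x => ?_⟩
  ext j
  refine Fin.succAboveCases i ?_ (fun k => ?_) j
  · simp [ι₀, lam, hi, mul_comm]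
  · simp [ι₀, π, lam, mul_comm]

/-- If the Jacobian of `n + 2` entire functions on `ℂ^(n+1)` vanishes identically, there is a
first order differential operator of which all of them are eigenfunctions. -/
lemma exists_eigen_operator {m : Fin (n + 2) → ℕ} {f : Fin (n + 2) → (Fin (n + 1) → ℂ) → ℂ}
    (hf : ∀ j, Differentiable ℂ (f j)) (hm : ∀ j, m j ≠ 0) (hf0 : ∃ j, f j ≠ 0)
    (hdet : ∀ x, (Matrix.of (Fin.cons (fun j => (m j : ℂ) * f j x)
      fun i j => fderiv ℂ (f j) x (Pi.single i 1)) : Matrix (Fin (n + 2)) (Fin (n + 2)) ℂ).det = 0) :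
    ∃ (U : (Fin (n + 1) → ℂ) → Fin (n + 1) → ℂ) (u₀ : (Fin (n + 1) → ℂ) → ℂ),
      Differentiable ℂ U ∧ Differentiable ℂ u₀ ∧ U ≠ 0 ∧
      ∀ j x, fderiv ℂ (f j) x (U x) = -(m j : ℂ) * u₀ x * f j x := by
  let R := entireRing (Fin (n + 1) → ℂ)
  let A : Matrix (Fin (n + 2)) (Fin (n + 2)) R := Matrix.of
    (Fin.cons (fun j => ⟨fun x => (m j : ℂ) * f j x, (hf j).const_mul _⟩)
      fun i j => ⟨fun x => fderiv ℂ (f j) x (Pi.single i 1), differentiable_fderiv_apply (hf j) _⟩)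
  let ev : (Fin (n + 1) → ℂ) → R →+* ℂ := fun x => (Pi.evalRingHom _ x).comp R.subtype
  have hA : A.det = 0 := by
    ext x
    have h := (ev x).map_det A
    have h2 : (ev x).mapMatrix A = Matrix.of (Fin.cons (fun j => (m j : ℂ) * f j x)
      fun i j => fderiv ℂ (f j) x (Pi.single i 1)) := by
      ext i j
      refine Fin.cases ?_ (fun i => ?_) i <;> rfl
    rw [h2, hdet] at h
    exact h
  obtain ⟨u, hu, huA⟩ := Matrix.exists_vecMul_eq_zero_iff.2 hA
  have hrel : ∀ j x, (u 0).1 x * ((m j : ℂ) * f j x) +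
      ∑ i : Fin (n + 1), (u i.succ).1 x * fderiv ℂ (f j) x (Pi.single i 1) = 0 := by
    intro j x
    have h := congrArg (ev x) (congrFun huA j)
    simp only [Matrix.vecMul, dotProduct, Fin.sum_univ_succ (n := n + 1), map_add, map_mul, map_sum,
      Pi.zero_apply, map_zero] at h
    exact h
  refine ⟨fun x i => (u i.succ).1 x, (u 0).1, differentiable_pi.2 fun i => (u i.succ).2, (u 0).2,
    fun hU => ?_, fun j x => ?_⟩
  · obtain ⟨j, hj⟩ := hf0
    -- If the vector field were zero, the relation would reduce to `u₀ m_j f_j = 0`; a nonzero `f_j`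
    -- would then kill the whole kernel vector.
    have hu0 : u 0 ≠ 0 := fun h0 => hu <| by
      ext i x
      refine Fin.cases ?_ (fun i => ?_) i
      · rw [h0]; rfl
      · exact congrFun (congrFun hU x) i
    rcases eq_zero_or_eq_zero_of_mul_eqOn_zero (U := Set.univ) isOpen_univ convex_univ
      (Differentiable.differentiableOn (u 0).2) (hf j).differentiableOn (fun x _ => by
        have h := hrel j x
        rw [Finset.sum_eq_zero fun i _ => by
          rw [show (u i.succ).1 x = 0 from congrFun (congrFun hU x) i, zero_mul], add_zero,
          mul_left_comm] at h
        exact (mul_eq_zero.1 h).resolve_left (by exact_mod_cast hm j)) with h | h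
    · exact hu0 (Subtype.ext (funext fun x => h x trivial))
    · exact hj (funext fun x => h x trivial)
  · have h := hrel j x
    have h1 : fderiv ℂ (f j) x (fun i => (u i.succ).1 x) =
        ∑ i : Fin (n + 1), (u i.succ).1 x * fderiv ℂ (f j) x (Pi.single i 1) := by
      refine (LinearMap.pi_apply_eq_sum_univ (fderiv ℂ (f j) x).toLinearMap _).trans
        (Finset.sum_congr rfl fun i _ => ?_)
      have h2 : (fun k => if i = k then (1 : ℂ) else 0) = Pi.single i 1 := by
        ext k
        simp [Pi.single_apply, eq_comm]
      rw [smul_eq_mul, h2]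
      rfl
    rw [h1]
    linear_combination h

/-- Entire functions on `ℂ^(n+1)` whose Jacobian vanishes satisfy a homogeneous relation, provided
that their growth is that of theta functions. -/
lemma exists_box_relation {m : Fin (n + 2) → ℕ} {f : Fin (n + 2) → (Fin (n + 1) → ℂ) → ℂ}
    (hf : ∀ j, Differentiable ℂ (f j)) (hm : ∀ j, m j ≠ 0)
    (hdet : ∀ x, (Matrix.of (Fin.cons (fun j => (m j : ℂ) * f j x)
      fun i j => fderiv ℂ (f j) x (Pi.single i 1)) : Matrix (Fin (n + 2)) (Fin (n + 2)) ℂ).det = 0)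
    {P : ℕ → ((Fin (n + 1) → ℂ) → ℂ) → Prop} (hP : IsGradedPredicate P)
    (hfP : ∀ j, P (m j) (f j)) {ρ : ℝ} (hρ : 0 ≤ ρ)
    (hgrowth : ∀ R : ℝ, ∃ A : ℝ, ∀ N F, P N F → ∀ z, ‖z‖ ≤ R →
      ∃ w, ‖w‖ ≤ ρ ∧ ‖F z‖ ≤ Real.exp (A * N) * ‖F w‖) :
    ∃ (s : ℕ) (c : (Fin (n + 1) → Fin (s + 1)) → ℂ), c ≠ 0 ∧
      ∀ x, ∑ a, c a * ∏ j, f j x ^ boxExponent m s a j = 0 := by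
  by_cases hf0 : ∃ j, f j ≠ 0
  swap
  · push Not at hf0
    -- All `f_j` are zero, so any monomial of positive degree is a relation.
    refine ⟨1, 1, one_ne_zero, fun x => Finset.sum_eq_zero fun a _ => ?_⟩
    have : ∃ j, boxExponent m 1 a j ≠ 0 := by
      by_contra! h
      have h1 := sum_boxExponent m 1 a
      simp only [h, zero_mul, Finset.sum_const_zero, mul_one] at h1
      exact (mul_ne_zero (Finset.prod_ne_zero_iff.2 fun j _ => hm j) (Nat.succ_ne_zero n)) h1.symm
    obtain ⟨j, hj⟩ := this
    rw [Finset.prod_eq_zero (Finset.mem_univ j) (by rw [hf0 j, Pi.zero_apply, zero_pow hj]),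
      mul_zero]
  obtain ⟨U, u₀, hU, hu₀, hU0, hrel⟩ := exists_eigen_operator hf hm hf0 hdet
  obtain ⟨z₀, hz₀⟩ := Function.ne_iff.1 hU0
  obtain ⟨ι, π, lam, hdec⟩ := exists_slice hz₀
  obtain ⟨A, hA⟩ := hgrowth (4 * (ρ + ‖z₀‖ + 1))
  set M := ∏ j, m j with hM
  -- The index is `M (n + 1) s`, so `A` times the index is at most `K s`; the order of vanishing
  -- will be `K (s + 1)`.
  set K := ⌈A * (M * (n + 1))⌉₊ + 1 with hK
  set s := K ^ n with hs
  -- The choice `s = K ^ n` gives `K ^ n (s + 1) ^ n < (s + 1) ^ (n + 1)`: fewer conditions on the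
  -- `n`-dimensional slice than monomials.
  have hcard : (K * (s + 1)) ^ n < Fintype.card (Fin (n + 1) → Fin (s + 1)) := by
    rw [Fintype.card_fun, Fintype.card_fin, Fintype.card_fin, mul_pow, pow_succ, mul_comm]
    exact Nat.mul_lt_mul_of_pos_left (by omega) (by positivity)
  obtain ⟨c, hc, hO⟩ := exists_combination_isBigO (K * (s + 1)) hcard
    (g := fun a y => ∏ j, f j (z₀ + ι y) ^ boxExponent m s a j) (fun a => by
      have h : ∀ j, Differentiable ℂ fun y => f j (z₀ + ι y) ^ boxExponent m s a j := fun j =>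
        ((hf j).comp (by fun_prop : Differentiable ℂ fun y => z₀ + ι y)).fun_pow _
      fun_prop)
  refine ⟨s, c, hc, ?_⟩
  set N := M * ((n + 1) * s) with hN
  set F : (Fin (n + 1) → ℂ) → ℂ := ∑ a, c a • ∏ j, f j ^ boxExponent m s a j with hF
  have hFx : ∀ x, F x = ∑ a, c a * ∏ j, f j x ^ boxExponent m s a j := fun x => by
    simp [hF, Finset.sum_apply, Finset.prod_apply]
  have hFP : P N F := hP.combination hfP (fun a => sum_boxExponent m s a) c
  obtain ⟨hFd, hFe⟩ := (isGradedPredicate_eigen U u₀).combination (fun j => ⟨hf j, hrel j⟩)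
    (fun a => sum_boxExponent m s a) c
  rw [← hF] at hFd hFe
  have hshift : (fun x => F (z₀ + x)) =O[𝓝 0] fun x => ‖x‖ ^ (K * (s + 1)) := by
    refine isBigO_of_slice (F := fun x => F (z₀ + x)) (a := fun x => -(N : ℂ) * u₀ (z₀ + x))
      (u := fun x => U (z₀ + x)) (hFd.comp (by fun_prop)) ?_ ?_ (fun x => ?_) ι π lam ?_ ?_
    · exact (continuous_const.mul (hu₀.continuous.comp (by fun_prop))).continuousAt
    · exact (hU.comp (by fun_prop : Differentiable ℂ fun x => z₀ + x)) 0
    · rw [fderiv_comp_add_left]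
      exact hFe (z₀ + x)
    · simpa using hdec
    · simpa only [hFx] using hO
  have hKpos : 0 < K := by omega
  have hB : Real.exp (A * N) < 3 ^ (K * (s + 1)) := by
    have h1 : A * N ≤ (K * (s + 1) : ℕ) := by
      have h2 : A * (M * (n + 1)) ≤ K := by
        rw [hK]; push_cast
        linarith [Nat.le_ceil (A * (M * (n + 1)))]
      rw [hN]
      push_cast
      calc A * (M * ((n + 1) * s)) = A * (M * (n + 1)) * s := by ring
        _ ≤ K * s := by gcongr
        _ ≤ K * (s + 1) := by gcongr; linarith
    -- The comparison of growth with order of vanishing comes down to `e < 3`.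
    calc Real.exp (A * N) ≤ Real.exp ((K * (s + 1) : ℕ) * 1) := by
          rw [mul_one]; exact Real.exp_le_exp.2 h1
      _ = Real.exp 1 ^ (K * (s + 1)) := Real.exp_nat_mul _ _
      _ < 3 ^ (K * (s + 1)) := pow_lt_pow_left₀ Real.exp_one_lt_three (Real.exp_pos _).le
          (by positivity)
  have hzero := eq_zero_of_isBigO_pow hFd hρ z₀ (by positivity) hB (fun z hz => hA N F hFP z hz) hshift
  intro x
  rw [← hFx]
  obtain ⟨A', hA'⟩ := hgrowth ‖x‖
  obtain ⟨w, hw, h⟩ := hA' N F hFP x le_rfl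
  rw [hzero w hw, norm_zero, mul_zero] at h
  exact norm_le_zero_iff.1 h

end SeveralVariables

/-! ### Holomorphy and Fourier expansion of the Jacobian. -/

section

variable {L : Type*} [AddCommGroup L]

section Holomorphic

/-- The derivative of `φ` in the lattice direction `v`. -/
def dirDeriv (v : Cplx L) (φ : ℍ → Cplx L → ℂ) : ℍ → Cplx L → ℂ :=
  fun τ z => deriv (fun s : ℂ => φ τ (z + s • v)) 0

lemma partialZ_eq_dirDeriv {l : ℕ} (b : Module.Basis (Fin l) ℂ (Cplx L)) (i : Fin l)
    (φ : ℍ → Cplx L → ℂ) : partialZ b i φ = dirDeriv (b i) φ := rfl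

/-- The function `φ` in linear coordinates. -/
def coordFun {n : ℕ} (b : Module.Basis (Fin n) ℂ (Cplx L)) (φ : ℍ → Cplx L → ℂ) :
    ℂ × (Fin n → ℂ) → ℂ :=
  fun p => φ (ofComplex p.1) (∑ i, p.2 i • b i)

/-- The function `φ τ` in linear coordinates. -/
def sliceFun {n : ℕ} (b : Module.Basis (Fin n) ℂ (Cplx L)) (φ : ℍ → Cplx L → ℂ) (τ : ℍ) :
    (Fin n → ℂ) → ℂ :=
  fun y => φ τ (∑ i, y i • b i)

lemma isOpen_halfPlane_prod (n : ℕ) : IsOpen {p : ℂ × (Fin n → ℂ) | 0 < p.1.im} :=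
  isOpen_lt continuous_const (Complex.continuous_im.comp continuous_fst)

lemma convex_halfPlane_prod (n : ℕ) : Convex ℝ {p : ℂ × (Fin n → ℂ) | 0 < p.1.im} := by
  intro p hp q hq a b ha hb hab
  simp only [Set.mem_ofPred_eq, Prod.fst_add, Prod.smul_fst, Complex.add_im, Complex.real_smul,
    Complex.im_ofReal_mul] at hp hq ⊢
  rcases ha.eq_or_lt with rfl | ha'
  · rw [zero_add] at hab; subst hab; simpa using hq
  · exact add_pos_of_pos_of_nonneg (mul_pos ha' hp) (mul_nonneg hb hq.le)

variable {n : ℕ} (b : Module.Basis (Fin n) ℂ (Cplx L)) {φ : ℍ → Cplx L → ℂ}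

lemma coordFun_apply (τ : ℍ) (y : Fin n → ℂ) :
    coordFun b φ ((τ : ℂ), y) = φ τ (∑ i, y i • b i) := by
  simp [coordFun]

lemma IsHolomorphic.differentiableAt_coordFun (hφ : IsHolomorphic φ) (τ : ℍ) (y : Fin n → ℂ) :
    DifferentiableAt ℂ (coordFun b φ) ((τ : ℂ), y) :=
  (hφ n b).differentiableAt ((isOpen_halfPlane_prod n).mem_nhds τ.im_pos)

lemma IsHolomorphic.differentiable_sliceFun (hφ : IsHolomorphic φ) (τ : ℍ) :
    Differentiable ℂ (sliceFun b φ τ) := by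
  intro y
  have h := (hφ.differentiableAt_coordFun b τ y).comp y
    (f := fun y : Fin n → ℂ => ((τ : ℂ), y)) (by fun_prop)
  refine h.congr_of_eventuallyEq (Filter.Eventually.of_forall fun y => ?_)
  rw [Function.comp_apply, coordFun_apply]
  rfl

lemma sum_coord_add_smul (y : Fin n → ℂ) (s : ℂ) (v : Cplx L) :
    ∑ i, (y + s • b.equivFun v) i • b i = ∑ i, y i • b i + s • v := by
  conv_rhs => rw [← b.sum_equivFun v, Finset.smul_sum]
  rw [← Finset.sum_add_distrib]
  refine Finset.sum_congr rfl fun i _ => ?_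
  rw [Pi.add_apply, Pi.smul_apply, add_smul, smul_smul, smul_eq_mul]

lemma IsHolomorphic.hasDerivAt_line (hφ : IsHolomorphic φ) (τ : ℍ) (y : Fin n → ℂ) (v : Cplx L) :
    HasDerivAt (fun s : ℂ => φ τ (∑ i, y i • b i + s • v))
      (fderiv ℂ (sliceFun b φ τ) y (b.equivFun v)) 0 := by
  have h1 : HasFDerivAt (sliceFun b φ τ) (fderiv ℂ (sliceFun b φ τ) y)
      (y + (0 : ℂ) • b.equivFun v) := by
    simpa using (hφ.differentiable_sliceFun b τ y).hasFDerivAt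
  have h2 : HasDerivAt (fun s : ℂ => y + s • b.equivFun v) (b.equivFun v) 0 := by
    simpa using ((hasDerivAt_id (0 : ℂ)).smul_const (b.equivFun v)).const_add y
  have h3 := HasFDerivAt.comp_hasDerivAt (0 : ℂ) h1 h2
  refine h3.congr_of_eventuallyEq (Filter.Eventually.of_forall fun s => ?_)
  simp only [Function.comp_apply, sliceFun, sum_coord_add_smul]

lemma IsHolomorphic.dirDeriv_eq (hφ : IsHolomorphic φ) (τ : ℍ) (y : Fin n → ℂ) (v : Cplx L) :
    dirDeriv v φ τ (∑ i, y i • b i) = fderiv ℂ (sliceFun b φ τ) y (b.equivFun v) :=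
  (hφ.hasDerivAt_line b τ y v).deriv

lemma IsHolomorphic.partialZ_eq (hφ : IsHolomorphic φ) (τ : ℍ) (y : Fin n → ℂ) (i : Fin n) :
    partialZ b i φ τ (∑ i, y i • b i) = fderiv ℂ (sliceFun b φ τ) y (Pi.single i 1) := by
  rw [partialZ_eq_dirDeriv, hφ.dirDeriv_eq]
  congr 1
  ext k
  simp [Pi.single_apply, eq_comm]

lemma IsHolomorphic.dirDeriv (hφ : IsHolomorphic φ) (v : Cplx L) :
    IsHolomorphic (dirDeriv v φ) := by
  intro n b
  refine (differentiableOn_fderiv_apply (isOpen_halfPlane_prod n) (hφ n b)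
    (0, b.equivFun v)).congr fun p hp => ?_
  obtain ⟨x, y⟩ := p
  have h := DifferentiableAt.deriv_comp_add_smul (𝕜 := ℂ) (f := coordFun b φ) (x := (x, y))
    (y := (0, b.equivFun v)) (t := 0) (by
      rw [zero_smul, add_zero]
      exact (hφ n b).differentiableAt ((isOpen_halfPlane_prod n).mem_nhds hp))
  rw [zero_smul, add_zero] at h
  refine Eq.trans ?_ h
  simp only [LatticeJacobi.dirDeriv, coordFun]
  congr 1
  ext s
  simp only [Prod.smul_mk, Prod.mk_add_mk, smul_zero, add_zero, sum_coord_add_smul]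

variable [Module.Finite ℤ L]

lemma IsHolomorphic.hasDerivAt_dirDeriv (hφ : IsHolomorphic φ) (τ : ℍ) (z v : Cplx L) :
    HasDerivAt (fun s : ℂ => φ τ (z + s • v)) (LatticeJacobi.dirDeriv v φ τ z) 0 := by
  have b := Module.finBasis ℂ (Cplx L)
  have h := hφ.hasDerivAt_line b τ (b.equivFun z) v
  rw [← hφ.dirDeriv_eq, b.sum_equivFun] at h
  exact h

lemma IsHolomorphic.dirDeriv_sum (hφ : IsHolomorphic φ) (τ : ℍ) (z : Cplx L) {ι : Type*}
    (s : Finset ι) (c : ι → ℂ) (v : ι → Cplx L) :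
    LatticeJacobi.dirDeriv (∑ i ∈ s, c i • v i) φ τ z =
      ∑ i ∈ s, c i * LatticeJacobi.dirDeriv (v i) φ τ z := by
  have b := Module.finBasis ℂ (Cplx L)
  have h : ∀ v, LatticeJacobi.dirDeriv v φ τ z =
      fderiv ℂ (sliceFun b φ τ) (b.equivFun z) (b.equivFun v) := fun v => by
    rw [← hφ.dirDeriv_eq, b.sum_equivFun]
  simp only [h, map_sum, map_smul, smul_eq_mul]

end Holomorphic

lemma isHolomorphic_jacobian {l : ℕ} (b : Module.Basis (Fin l) ℂ (Cplx L)) (m : Fin (l + 1) → ℕ)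
    {φ : Fin (l + 1) → ℍ → Cplx L → ℂ} (hφ : ∀ j, IsHolomorphic (φ j)) :
    IsHolomorphic (jacobian b m φ) := by
  intro n b'
  simp only [jacobian, Matrix.det_apply]
  have h : ∀ i j, DifferentiableOn ℂ (fun p : ℂ × (Fin n → ℂ) =>
      jacobianMatrix b m φ (ofComplex p.1) (∑ i, p.2 i • b' i) i j) {p | 0 < p.1.im} := by
    intro i j
    refine Fin.cases ?_ (fun i => ?_) i
    · exact (hφ j n b').const_mul _
    · exact (hφ j).dirDeriv (b i) n b'
  refine DifferentiableOn.fun_sum fun σ _ => DifferentiableOn.fun_const_smul ?_ _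
  intro p hp
  exact (HasFDerivWithinAt.finsetProd fun j _ =>
    (h (σ j) j p hp).hasFDerivWithinAt).differentiableWithinAt

section Fourier

variable (B : LinearMap.BilinForm ℤ L)

/-- The exponential `exp (2πi (nτ + (ℓ, z)))`. -/
def fourierExp (τ : ℍ) (z : Cplx L) (p : ℕ × dualLattice B) : ℂ :=
  Complex.exp (2 * Real.pi * Complex.I * ((p.1 : ℂ) * τ + cform B (p.2 : Cplx L) z))

lemma fourierExp_add (τ : ℍ) (z : Cplx L) (p q : ℕ × dualLattice B) :
    fourierExp B τ z (p + q) = fourierExp B τ z p * fourierExp B τ z q := by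
  simp only [fourierExp, ← Complex.exp_add]
  congr 1
  simp
  ring

/-- `φ` has a Fourier expansion. -/
def HasFourier (φ : ℍ → Cplx L → ℂ) : Prop :=
  ∃ f : ℕ × dualLattice B → ℂ, ∀ τ z, HasSum (fun p => f p * fourierExp B τ z p) (φ τ z)

variable {B}

lemma IsWeakJacobiForm.hasFourier {G : Subgroup (L ≃ₗ[ℤ] L)} {k : ℤ} {t : ℕ}
    {φ : ℍ → Cplx L → ℂ} (h : IsWeakJacobiForm B G k t φ) : HasFourier B φ := by
  obtain ⟨f, hf⟩ := h.fourier
  exact ⟨fun p => f p.1 p.2, hf⟩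

/-- Convergence in `ℂ` is absolute, so the double series may be regrouped along the fibres of
addition. In the application the fibres can be infinite, whence coefficients given by `tsum`. -/
lemma hasSum_convolution {S : Type*} [Add S] {e f g : S → ℂ} {x y : ℂ}
    (he : ∀ p q, e (p + q) = e p * e q) (hf : HasSum (fun p => f p * e p) x)
    (hg : HasSum (fun p => g p * e p) y) :
    HasSum (fun r => (∑' x : {x : S × S // x.1 + x.2 = r}, f x.1.1 * g x.1.2) * e r) (x * y) := by
  have hprod : HasSum (fun x : S × S => (f x.1 * e x.1) * (g x.2 * e x.2)) (x * y) :=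
    HasSum.mul (f := fun p => f p * e p) (g := fun p => g p * e p) hf hg
      (summable_mul_of_summable_norm (f := fun p => f p * e p) (g := fun p => g p * e p)
        hf.summable.norm hg.summable.norm)
  have hsig := (Equiv.sigmaFiberEquiv fun x : S × S => x.1 + x.2).hasSum_iff.2 hprod
  refine hsig.sigma fun r => ?_
  have h2 := (hsig.summable.sigma_factor r).hasSum
  have hval : ∀ x : {x : S × S // x.1 + x.2 = r},
      (f x.1.1 * e x.1.1) * (g x.1.2 * e x.1.2) = f x.1.1 * g x.1.2 * e r := by
    rintro ⟨⟨p, q⟩, h⟩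
    simp only
    rw [← h, he]
    ring
  rw [← tsum_mul_right]
  simp only [← hval]
  exact h2

namespace HasFourier

variable {φ ψ : ℍ → Cplx L → ℂ}

lemma add (hφ : HasFourier B φ) (hψ : HasFourier B ψ) : HasFourier B (φ + ψ) := by
  obtain ⟨f, hf⟩ := hφ
  obtain ⟨g, hg⟩ := hψ
  refine ⟨f + g, fun τ z => ?_⟩
  simpa [add_mul] using (hf τ z).add (hg τ z)

lemma const_mul (hφ : HasFourier B φ) (c : ℂ) : HasFourier B (fun τ z => c * φ τ z) := by
  obtain ⟨f, hf⟩ := hφ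
  refine ⟨fun p => c * f p, fun τ z => ?_⟩
  simpa [mul_assoc] using (hf τ z).mul_left c

lemma const (c : ℂ) : HasFourier B fun _ _ => c := by
  classical
  refine ⟨fun p => if p = 0 then c else 0, fun τ z => ?_⟩
  have h := hasSum_ite_eq (0 : ℕ × dualLattice B) c
  have e : (fun p : ℕ × dualLattice B => (if p = 0 then c else 0) * fourierExp B τ z p) =
      fun p => if p = 0 then c else 0 := by
    funext p
    split_ifs with hp
    · rw [hp]
      simp [fourierExp]
    · rw [zero_mul]
  rw [e]
  exact h

lemma mul (hφ : HasFourier B φ) (hψ : HasFourier B ψ) :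
    HasFourier B (fun τ z => φ τ z * ψ τ z) := by
  obtain ⟨f, hf⟩ := hφ
  obtain ⟨g, hg⟩ := hψ
  refine ⟨fun r => ∑' x : {x : (ℕ × dualLattice B) × (ℕ × dualLattice B) // x.1 + x.2 = r},
    f x.1.1 * g x.1.2, fun τ z => ?_⟩
  exact hasSum_convolution (fourierExp_add B τ z) (hf τ z) (hg τ z)

lemma sum {ι : Type*} (s : Finset ι) {φ : ι → ℍ → Cplx L → ℂ} (h : ∀ i ∈ s, HasFourier B (φ i)) :
    HasFourier B (fun τ z => ∑ i ∈ s, φ i τ z) := by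
  classical
  induction s using Finset.induction_on with
  | empty => simpa using const 0
  | insert i s hi ih =>
    simp only [Finset.sum_insert hi]
    exact (h i (by simp)).add (ih fun j hj => h j (by simp [hj]))

lemma prod {ι : Type*} (s : Finset ι) {φ : ι → ℍ → Cplx L → ℂ} (h : ∀ i ∈ s, HasFourier B (φ i)) :
    HasFourier B (fun τ z => ∏ i ∈ s, φ i τ z) := by
  classical
  induction s using Finset.induction_on with
  | empty => simpa using const 1
  | insert i s hi ih =>
    simp only [Finset.prod_insert hi]
    exact (h i (by simp)).mul (ih fun j hj => h j (by simp [hj]))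

/-- Up to a factor 2, `‖w‖` is bounded by one of `±Re w`, `±Im w`, and these are real parts of
multiples of `w`. The right side thus consists of quantities obtained by evaluating a Fourier series
at shifted points. -/
lemma exp_norm_le (w : ℂ) : Real.exp ‖w‖ ≤ Real.exp (2 * w).re + Real.exp (-2 * w).re +
    Real.exp (2 * Complex.I * w).re + Real.exp (-2 * Complex.I * w).re := by
  have h1 := Complex.norm_le_abs_re_add_abs_im w
  have e1 : (2 * w).re = 2 * w.re := by simp
  have e2 : (-2 * w).re = -(2 * w.re) := by simp
  have e3 : (2 * Complex.I * w).re = -(2 * w.im) := by simp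
  have e4 : (-2 * Complex.I * w).re = 2 * w.im := by simp
  rw [e1, e2, e3, e4]
  have p1 := Real.exp_pos (2 * w.re)
  have p2 := Real.exp_pos (-(2 * w.re))
  have p3 := Real.exp_pos (2 * w.im)
  have p4 := Real.exp_pos (-(2 * w.im))
  rcases le_total |w.re| |w.im| with h | h
  · have h2 : Real.exp ‖w‖ ≤ Real.exp (2 * |w.im|) := Real.exp_le_exp.2 (by linarith)
    rcases abs_cases w.im with ⟨h3, _⟩ | ⟨h3, _⟩ <;> rw [h3] at h2
    · linarith
    · rw [mul_neg] at h2; linarith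
  · have h2 : Real.exp ‖w‖ ≤ Real.exp (2 * |w.re|) := Real.exp_le_exp.2 (by linarith)
    rcases abs_cases w.re with ⟨h3, _⟩ | ⟨h3, _⟩ <;> rw [h3] at h2
    · linarith
    · rw [mul_neg] at h2; linarith

lemma _root_.LatticeJacobi.fourierExp_add_smul (τ : ℍ) (z v : Cplx L) (s : ℂ)
    (p : ℕ × dualLattice B) : fourierExp B τ (z + s • v) p =
      fourierExp B τ z p * Complex.exp (s * (2 * Real.pi * Complex.I * cform B (p.2 : Cplx L) v)) := by
  simp only [fourierExp, ← Complex.exp_add, map_add, map_smul, smul_eq_mul]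
  congr 1
  ring

/-- Absolute convergence at the four points `z ± 2v`, `z ± 2iv` yields a majorant valid for all
shifts `z + s v` with `‖s‖ ≤ 1`, which permits termwise differentiation and uniform bounds. -/
lemma summable_norm_mul_exp {f : ℕ × dualLattice B → ℂ}
    (hf : ∀ τ z, HasSum (fun p => f p * fourierExp B τ z p) (φ τ z)) (τ : ℍ) (z v : Cplx L) :
    Summable fun p : ℕ × dualLattice B => ‖f p * fourierExp B τ z p‖ *
      Real.exp ‖2 * Real.pi * Complex.I * cform B (p.2 : Cplx L) v‖ := by
  let w : ℕ × dualLattice B → ℂ := fun p => 2 * Real.pi * Complex.I * cform B (p.2 : Cplx L) v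
  have hnorm : ∀ θ : ℂ, Summable fun p => ‖f p * fourierExp B τ z p‖ * Real.exp (θ * w p).re := by
    intro θ
    refine (hf τ (z + θ • v)).summable.norm.congr fun p => ?_
    rw [fourierExp_add_smul, ← mul_assoc, norm_mul, Complex.norm_exp]
  refine Summable.of_nonneg_of_le (fun p => by positivity) (fun p => ?_)
    ((((hnorm 2).add (hnorm (-2))).add (hnorm (2 * Complex.I))).add (hnorm (-2 * Complex.I)))
  simp only [← mul_add]
  exact mul_le_mul_of_nonneg_left (exp_norm_le (w p)) (norm_nonneg _)

lemma dirDeriv (hφ : HasFourier B φ) (v : Cplx L) : HasFourier B (dirDeriv v φ) := by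
  obtain ⟨f, hf⟩ := hφ
  let w : ℕ × dualLattice B → ℂ := fun p => 2 * Real.pi * Complex.I * cform B (p.2 : Cplx L) v
  refine ⟨fun p => f p * w p, fun τ z => ?_⟩
  let F : ℕ × dualLattice B → ℂ → ℂ := fun p s =>
    f p * (fourierExp B τ z p * Complex.exp (s * w p))
  have hF : ∀ s, HasSum (fun p => F p s) (φ τ (z + s • v)) := fun s => by
    simpa only [fourierExp_add_smul] using hf τ (z + s • v)
  have hu : Summable fun p => ‖f p * fourierExp B τ z p‖ * Real.exp ‖w p‖ :=
    summable_norm_mul_exp hf τ z v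
  have hder := Complex.hasSum_deriv_of_summable_norm (F := F) (U := Metric.ball 0 1)
    (z := 0) hu (fun p => by
      refine Differentiable.differentiableOn ?_
      simp only [F]
      fun_prop) Metric.isOpen_ball
    (fun p s hs => by
      rw [mem_ball_zero_iff] at hs
      simp only [F, ← mul_assoc, norm_mul _ (Complex.exp _), Complex.norm_exp]
      gcongr
      calc (s * w p).re ≤ ‖s * w p‖ := Complex.re_le_norm _
        _ ≤ 1 * ‖w p‖ := by rw [norm_mul]; gcongr
        _ = ‖w p‖ := one_mul _) (Metric.mem_ball_self one_pos)
  have e : (fun s => ∑' p, F p s) = fun s => φ τ (z + s • v) := by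
    ext s; exact (hF s).tsum_eq
  rw [e] at hder
  refine hder.congr_fun fun p => ?_
  have hd : HasDerivAt (F p) (f p * (fourierExp B τ z p * (Complex.exp (0 * w p) * (1 * w p)))) 0 :=
    ((((hasDerivAt_id (0 : ℂ)).mul_const (w p)).cexp).const_mul _).const_mul _
  rw [hd.deriv]
  simp
  ring

end HasFourier

lemma hasFourier_jacobian {l : ℕ} (b : Module.Basis (Fin l) ℂ (Cplx L)) (m : Fin (l + 1) → ℕ)
    {φ : Fin (l + 1) → ℍ → Cplx L → ℂ} (hφ : ∀ j, HasFourier B (φ j)) :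
    HasFourier B (jacobian b m φ) := by
  have h : jacobian b m φ = fun τ z => ∑ σ : Equiv.Perm (Fin (l + 1)),
      ((Equiv.Perm.sign σ : ℤ) : ℂ) * ∏ i, jacobianMatrix b m φ τ z (σ i) i := by
    ext τ z
    simp only [jacobian, Matrix.det_apply']
  rw [h]
  refine HasFourier.sum _ fun σ _ => (HasFourier.prod _ fun j _ => ?_).const_mul _
  generalize σ j = i
  refine Fin.cases ?_ (fun i => ?_) i
  · exact (hφ j).const_mul _
  · exact (hφ j).dirDeriv (b i)

end Fourier

end

/-! ### Transformation laws of the Jacobian and vanishing on mirrors. -/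

section

variable {L : Type*} [AddCommGroup L]

/-- Adding multiples of row 0 to the others leaves the determinant unchanged; `a` is extracted from
the `l` lower rows and `d j` from the columns. -/
lemma det_of_row_col_transform {l : ℕ} {M M' : Matrix (Fin (l + 1)) (Fin (l + 1)) ℂ} (a : ℂ)
    (d : Fin (l + 1) → ℂ) (v : Fin l → ℂ) (h0 : ∀ j, M' 0 j = d j * M 0 j)
    (hs : ∀ i j, M' (Fin.succ i) j = a * d j * (M (Fin.succ i) j + v i * M 0 j)) :
    M'.det = a ^ l * (∏ j, d j) * M.det := by
  let N : Matrix (Fin (l + 1)) (Fin (l + 1)) ℂ :=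
    fun i j => M i j + (Fin.cons 0 v : Fin (l + 1) → ℂ) i * M 0 j
  have hN : N.det = M.det :=
    Matrix.det_eq_of_forall_row_eq_smul_add_const (Fin.cons 0 v) 0 (by simp) fun i j => rfl
  have hM' : M' = Matrix.of fun i j => d j *
      (Matrix.of fun i j => (Fin.cons 1 (fun _ => a) : Fin (l + 1) → ℂ) i * N i j) i j := by
    ext i j
    refine Fin.cases ?_ (fun i => ?_) i
    · simp [N, h0]
    · simp [N, hs]
      ring
  rw [hM', Matrix.det_mul_row, Matrix.det_mul_column, hN, Fin.prod_univ_succ (n := l)]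
  simp
  ring

section

variable {B : LinearMap.BilinForm ℤ L}

lemma cform_incl (x y : L) : cform B (incl x) (incl y) = B x y := by
  simp [cform, incl]

lemma cform_symm (hB : IsEvenPosDef B) (z w : Cplx L) : cform B z w = cform B w z := by
  induction z using TensorProduct.induction_on with
  | zero => simp
  | add a b ha hb => simp [ha, hb]
  | tmul c x =>
    induction w using TensorProduct.induction_on with
    | zero => simp
    | add a b ha hb => simp [ha, hb]
    | tmul d y => simp [cform, hB.symm x y, mul_comm]

/-- The logarithmic derivative of the `j`-th factor is `m j` times a quantity `v w` common to all
`j`. This is why the entries of the first row carry the factor `m j`. -/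
lemma jacobian_transform {l : ℕ} (b : Module.Basis (Fin l) ℂ (Cplx L)) (m : Fin (l + 1) → ℕ)
    (φ : Fin (l + 1) → ℍ → Cplx L → ℂ) (τ τ' : ℍ) (z z' : Cplx L) (a : ℂ)
    (d : Fin (l + 1) → ℂ) (v : Cplx L → ℂ) (h0 : ∀ j, φ j τ' z' = d j * φ j τ z)
    (hs : ∀ j w, dirDeriv w (φ j) τ' z' =
      a * d j * (dirDeriv w (φ j) τ z + m j * v w * φ j τ z)) :
    jacobian b m φ τ' z' = a ^ l * (∏ j, d j) * jacobian b m φ τ z := by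
  refine det_of_row_col_transform a d (fun i => v (b i)) (fun j => ?_) fun i j => ?_
  · simp only [jacobianMatrix, Matrix.of_apply, Fin.cons_zero, h0]
    ring
  · simp only [jacobianMatrix, Matrix.of_apply, Fin.cons_zero, Fin.cons_succ,
      partialZ_eq_dirDeriv, hs]
    ring

variable {G : Subgroup (L ≃ₗ[ℤ] L)} {k : ℤ} {t : ℕ} {φ : ℍ → Cplx L → ℂ}

lemma cform_incl_ne_zero (hB : IsEvenPosDef B) {r : L} (hr : r ≠ 0) :
    cform B (incl r) (incl r) ≠ 0 := by
  rw [cform_incl]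
  exact_mod_cast (hB.posDef r hr).ne'

variable [Module.Finite ℤ L]

lemma IsWeakJacobiForm.dirDeriv_modular (hB : IsEvenPosDef B) (h : IsWeakJacobiForm B G k t φ)
    (γ : SL(2, ℤ)) (τ : ℍ) (z w : Cplx L) (hne : (γ 1 0 : ℂ) * τ + (γ 1 1 : ℂ) ≠ 0) :
    dirDeriv w φ (γ • τ) (((γ 1 0 : ℂ) * τ + (γ 1 1 : ℂ))⁻¹ • z) =
      ((γ 1 0 : ℂ) * τ + (γ 1 1 : ℂ)) * (((γ 1 0 : ℂ) * τ + (γ 1 1 : ℂ)) ^ k *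
        Complex.exp (t * Real.pi * Complex.I *
          ((γ 1 0 : ℂ) * cform B z z / ((γ 1 0 : ℂ) * τ + (γ 1 1 : ℂ))))) *
      (dirDeriv w φ τ z + t * (2 * Real.pi * Complex.I * (γ 1 0 : ℂ) * cform B z w /
        ((γ 1 0 : ℂ) * τ + (γ 1 1 : ℂ))) * φ τ z) := by
  set c := (γ 1 0 : ℂ)
  set j := c * (τ : ℂ) + (γ 1 1 : ℂ) with hj
  have hfun : (fun s : ℂ => φ (γ • τ) (j⁻¹ • z + s • w)) = fun s =>
      j ^ k * Complex.exp (t * Real.pi * Complex.I *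
        (c * cform B (z + (s * j) • w) (z + (s * j) • w) / j)) * φ τ (z + (s * j) • w) := by
    ext s
    have h1 := h.modular γ τ (z + (s * j) • w)
    rw [← hj] at h1
    rw [← h1]
    congr 1
    rw [smul_add, smul_smul, mul_comm s j, inv_mul_cancel_left₀ hne]
  have hlin : HasDerivAt (fun s : ℂ => s * j) j 0 := by
    simpa using (hasDerivAt_id (0 : ℂ)).mul_const j
  have h2 : HasDerivAt (fun s : ℂ => φ τ (z + (s * j) • w)) (dirDeriv w φ τ z * j) 0 := by
    have h0 := h.holomorphic.hasDerivAt_dirDeriv τ z w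
    exact HasDerivAt.comp (0 : ℂ) (h₂ := fun s : ℂ => φ τ (z + s • w)) (by simpa using h0) hlin
  have hq : (fun s : ℂ => cform B (z + (s * j) • w) (z + (s * j) • w)) = fun s =>
      cform B z z + (s * j) * (2 * cform B z w) + (s * j) ^ 2 * cform B w w := by
    ext s
    simp only [map_add, map_smul, LinearMap.add_apply, LinearMap.smul_apply, smul_eq_mul,
      cform_symm hB w z]
    ring
  have h3 : HasDerivAt (fun s : ℂ => cform B (z + (s * j) • w) (z + (s * j) • w))
      (j * (2 * cform B z w)) 0 := by
    rw [hq]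
    exact (((hlin.mul_const (2 * cform B z w)).const_add (cform B z z)).fun_add
      ((hlin.fun_pow 2).mul_const (cform B w w))).congr_deriv (by simp)
  have h4 := ((((h3.const_mul c).div_const j).const_mul (t * Real.pi * Complex.I)).cexp.const_mul
    (j ^ k)).mul h2
  have h5 : dirDeriv w φ (γ • τ) (j⁻¹ • z) =
    deriv (fun s : ℂ => φ (γ • τ) (j⁻¹ • z + s • w)) 0 := rfl
  rw [h5, hfun]
  refine h4.deriv.trans ?_
  simp only [zero_mul, zero_smul, add_zero]
  field_simp
  ring

lemma IsWeakJacobiForm.dirDeriv_quasiPeriodic (h : IsWeakJacobiForm B G k t φ) (x y : L) (τ : ℍ)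
    (z w : Cplx L) :
    dirDeriv w φ τ (z + (τ : ℂ) • incl x + incl y) =
      1 * Complex.exp (-(t * Real.pi * Complex.I *
        (cform B (incl x) (incl x) * τ + 2 * cform B (incl x) z))) *
      (dirDeriv w φ τ z + t * (-(2 * Real.pi * Complex.I * cform B (incl x) w)) * φ τ z) := by
  have hfun : (fun s : ℂ => φ τ (z + (τ : ℂ) • incl x + incl y + s • w)) = fun s =>
      Complex.exp (-(t * Real.pi * Complex.I *
        (cform B (incl x) (incl x) * τ + 2 * (cform B (incl x) z + s * cform B (incl x) w)))) *
        φ τ (z + s • w) := by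
    ext s
    have h1 := h.quasiPeriodic x y τ (z + s • w)
    rw [map_add, map_smul, smul_eq_mul] at h1
    rw [← h1]
    congr 1
    abel
  have h2 := h.holomorphic.hasDerivAt_dirDeriv τ z w
  have h4 := (((((((hasDerivAt_id (0 : ℂ)).mul_const (cform B (incl x) w)).const_add
    (cform B (incl x) z)).const_mul 2).const_add (cform B (incl x) (incl x) * τ)).const_mul
      (t * Real.pi * Complex.I)).neg.cexp).mul h2
  have h5 : dirDeriv w φ τ (z + (τ : ℂ) • incl x + incl y) =
    deriv (fun s : ℂ => φ τ (z + (τ : ℂ) • incl x + incl y + s • w)) 0 := rfl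
  rw [h5, hfun]
  refine h4.deriv.trans ?_
  simp only [Pi.neg_apply, id, zero_mul, zero_smul, add_zero]
  ring

end

lemma prod_zpow_eq_zpow_sum {ι : Type*} (s : Finset ι) {a : ℂ} (ha : a ≠ 0) (k : ι → ℤ) :
    ∏ i ∈ s, a ^ k i = a ^ ∑ i ∈ s, k i := by
  classical
  induction s using Finset.induction_on with
  | empty => simp
  | insert i s hi ih => rw [Finset.prod_insert hi, Finset.sum_insert hi, zpow_add₀ ha, ih]

lemma automorphyFactor_ne_zero (γ : SL(2, ℤ)) (τ : ℍ) : (γ 1 0 : ℂ) * τ + (γ 1 1 : ℂ) ≠ 0 := by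
  have h := UpperHalfPlane.denom_ne_zero (γ : GL (Fin 2) ℝ) τ
  rwa [ModularGroup.denom_apply] at h

lemma dirDeriv_cact {φ : ℍ → Cplx L → ℂ} {σ : L ≃ₗ[ℤ] L}
    (h : ∀ τ z, φ τ (cact σ z) = φ τ z) (w : Cplx L) (τ : ℍ) (z : Cplx L) :
    dirDeriv (cact σ w) φ τ (cact σ z) = dirDeriv w φ τ z := by
  unfold dirDeriv
  congr 1
  ext s
  rw [← map_smul, ← map_add, h]

variable [Module.Finite ℤ L] {B : LinearMap.BilinForm ℤ L} {G : Subgroup (L ≃ₗ[ℤ] L)}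

section

variable {l : ℕ} (b : Module.Basis (Fin l) ℂ (Cplx L)) {k : Fin (l + 1) → ℤ} {m : Fin (l + 1) → ℕ}
  {φ : Fin (l + 1) → ℍ → Cplx L → ℂ}

lemma isWeakJacobiForm_jacobian (hB : IsEvenPosDef B)
    (hφ : ∀ j, IsWeakJacobiForm B G (k j) (m j) (φ j)) :
    IsWeakJacobiForm B ⊥ ((l : ℤ) + ∑ j, k j) (∑ j, m j) (jacobian b m φ) where
  holomorphic := isHolomorphic_jacobian b m fun j => (hφ j).holomorphic
  modular γ τ z := by
    have hne := automorphyFactor_ne_zero γ τ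
    rw [jacobian_transform b m φ τ (γ • τ) z _ ((γ 1 0 : ℂ) * τ + (γ 1 1 : ℂ)) _
      (fun w => 2 * Real.pi * Complex.I * (γ 1 0 : ℂ) * cform B z w /
        ((γ 1 0 : ℂ) * τ + (γ 1 1 : ℂ))) (fun j => (hφ j).modular γ τ z)
      fun j w => (hφ j).dirDeriv_modular hB γ τ z w hne]
    rw [Finset.prod_mul_distrib, prod_zpow_eq_zpow_sum _ hne, ← Complex.exp_sum, zpow_add₀ hne,
      zpow_natCast]
    push_cast
    simp only [← Finset.sum_mul]
    ring
  quasiPeriodic x y τ z := by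
    rw [jacobian_transform b m φ τ τ z _ 1 _
      (fun w => -(2 * Real.pi * Complex.I * cform B (incl x) w))
      (fun j => (hφ j).quasiPeriodic x y τ z)
      fun j w => (hφ j).dirDeriv_quasiPeriodic x y τ z w]
    rw [← Complex.exp_sum, one_pow, one_mul, Finset.sum_neg_distrib]
    push_cast
    simp only [← Finset.sum_mul]
  fourier := by
    obtain ⟨f, hf⟩ := hasFourier_jacobian b m fun j => (hφ j).hasFourier
    exact ⟨fun n ℓ => f (n, ℓ), hf⟩
  invariant σ hσ τ z := by
    rw [Subgroup.mem_bot] at hσ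
    subst hσ
    congr 1
    exact congrFun (congrArg DFunLike.coe (LinearMap.baseChange_id (A := ℂ) (R := ℤ) (M := L))) z

/-- By the chain rule the gradient rows at `z` and at `σ z` differ by the transposed matrix of `σ`,
while the first row is invariant. -/
lemma jacobian_cact [Module.Free ℤ L] (hφ : ∀ j, IsWeakJacobiForm B G (k j) (m j) (φ j))
    {σ : L ≃ₗ[ℤ] L} (hσ : σ ∈ G) (τ : ℍ) (z : Cplx L) :
    jacobian b m φ τ (cact σ z) =
      ((LinearMap.det (σ : L →ₗ[ℤ] L) : ℤ) : ℂ) * jacobian b m φ τ z := by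
  set S := LinearMap.toMatrix b b (cact σ) with hS
  have hdet : S.det = ((LinearMap.det (σ : L →ₗ[ℤ] L) : ℤ) : ℂ) := by
    rw [hS, LinearMap.det_toMatrix, cact, LinearMap.det_baseChange]
    rfl
  have hb : ∀ i, cact σ (b i) = ∑ k, S k i • b k := fun i => by
    conv_lhs => rw [← b.sum_repr (cact σ (b i))]
    simp [hS, LinearMap.toMatrix_apply]
  let S' : Matrix (Fin (l + 1)) (Fin (l + 1)) ℂ :=
    Matrix.of (Fin.cons (Fin.cons 1 0) fun i => Fin.cons 0 fun j => S j i)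
  have hS' : S'.det = S.det := by
    rw [Matrix.det_succ_row_zero, Fin.sum_univ_succ, Finset.sum_eq_zero fun i _ => by simp [S']]
    simp only [S', Matrix.of_apply, Fin.cons_zero, Fin.val_zero, pow_zero, one_mul, add_zero]
    rw [← Matrix.det_transpose S]
    congr 1
  have hmul : jacobianMatrix b m φ τ z = S' * jacobianMatrix b m φ τ (cact σ z) := by
    ext i j
    rw [Matrix.mul_apply, Fin.sum_univ_succ]
    refine Fin.cases ?_ (fun i => ?_) i
    · simp [jacobianMatrix, S', (hφ j).invariant σ hσ]
    · simp only [jacobianMatrix, S', Matrix.of_apply, Fin.cons_zero, Fin.cons_succ, zero_mul,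
        zero_add, partialZ_eq_dirDeriv]
      rw [← dirDeriv_cact ((hφ j).invariant σ hσ), hb, (hφ j).holomorphic.dirDeriv_sum]
  have h1 : jacobian b m φ τ z = S.det * jacobian b m φ τ (cact σ z) := by
    simp only [jacobian]
    rw [hmul, Matrix.det_mul, hS']
  rw [h1, hdet, ← mul_assoc]
  -- An automorphism of `L` has determinant `±1`, so the factor may change sides.
  have hu : IsUnit (LinearMap.det (σ : L →ₗ[ℤ] L)) := LinearEquiv.isUnit_det' σ
  rcases Int.isUnit_iff.1 hu with h | h <;> simp [h]

/-- A reflection is a transvection `v ↦ v + f(v) r` with `f(r) = -2`, of determinant `1 + f(r)`. -/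
lemma det_eq_neg_one_of_reflect [Module.Free ℤ L] (hB : IsEvenPosDef B) {r : L} (hr : r ≠ 0)
    {σ : L ≃ₗ[ℤ] L} (hσ : ∀ v, cact σ v = reflect B r v) :
    LinearMap.det (σ : L →ₗ[ℤ] L) = -1 := by
  have hrr := cform_incl_ne_zero hB hr
  have h1 : cact σ = LinearMap.transvection
      ((-(2 / cform B (incl r) (incl r))) • cform B (incl r)) (incl r) := by
    refine LinearMap.ext fun v => ?_
    rw [LinearMap.transvection.apply, hσ, reflect, sub_eq_add_neg, ← _root_.neg_smul]
    congr 2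
    rw [LinearMap.smul_apply, smul_eq_mul]
    ring
  have h2 : LinearMap.det (cact σ) = -1 := by
    rw [h1, LinearMap.transvection.det, LinearMap.smul_apply, smul_eq_mul, neg_mul,
      div_mul_cancel₀ _ hrr]
    norm_num
  rw [cact, LinearMap.det_baseChange] at h2
  have h3 : ((LinearMap.det (σ : L →ₗ[ℤ] L) : ℤ) : ℂ) = ((-1 : ℤ) : ℂ) := by
    simpa using h2
  exact_mod_cast h3

lemma jacobian_eq_zero_on_mirrors [Module.Free ℤ L] (hB : IsEvenPosDef B)
    (hφ : ∀ j, IsWeakJacobiForm B G (k j) (m j) (φ j)) {r : L} (hr : r ≠ 0)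
    {σ : L ≃ₗ[ℤ] L} (hσG : σ ∈ G) (hσ : ∀ v, cact σ v = reflect B r v)
    {p : ℍ × Cplx L} (hp : p ∈ mirrors B r) : jacobian b m φ p.1 p.2 = 0 := by
  obtain ⟨τ, z⟩ := p
  obtain ⟨u, v, huv⟩ := hp
  simp only at huv ⊢
  have hrr := cform_incl_ne_zero hB hr
  set q := cform B (incl r) (incl r) with hq
  have hrz : 2 * cform B (incl r) z / q = u * (τ : ℂ) + v := by
    rw [← huv, coroot, map_smul, LinearMap.smul_apply, smul_eq_mul]
    ring
  have hincl : ∀ n : ℤ, incl (n • r) = (n : ℂ) • incl r := fun n => by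
    rw [incl, incl, TensorProduct.smul_tmul', ← TensorProduct.smul_tmul]
    simp
  have h1 : cact σ z = z + (τ : ℂ) • incl ((-u) • r) + incl ((-v) • r) := by
    rw [hσ, reflect, ← hq, hrz, hincl, hincl, smul_smul, add_assoc, ← add_smul, sub_eq_add_neg,
      ← _root_.neg_smul]
    congr 2
    push_cast
    ring
  have hJ := jacobian_cact b hφ hσG τ z
  rw [det_eq_neg_one_of_reflect hB hr hσ, h1,
    (isWeakJacobiForm_jacobian b hB hφ).quasiPeriodic, hincl] at hJ
  obtain ⟨e, he⟩ := hB.even r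
  have hqe : q = 2 * e := by
    rw [hq, cform_incl, he]
    push_cast
    ring
  have hrz' : 2 * cform B (incl r) z = q * (u * τ + v) := by
    rw [← hrz, mul_div_cancel₀ _ hrr]
  -- Substituting `2 (r, z) = (r, r) (uτ + v)` cancels the terms in `τ` and leaves `π i t u v (r,
  -- r)`, a multiple of `2π i` because `(r, r) = 2e`.
  have hexp : Complex.exp (-(((∑ j, m j : ℕ) : ℂ) * Real.pi * Complex.I *
      (cform B (((-u : ℤ) : ℂ) • incl r) (((-u : ℤ) : ℂ) • incl r) * τ +
        2 * cform B (((-u : ℤ) : ℂ) • incl r) z))) = 1 := by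
    rw [Complex.exp_eq_one_iff]
    refine ⟨((∑ j, m j : ℕ) : ℤ) * e * u * v, ?_⟩
    simp only [map_smul, LinearMap.smul_apply, smul_eq_mul, ← hq]
    push_cast
    have : 2 * (-(u : ℂ) * cform B (incl r) z) = -u * (q * (u * τ + v)) := by
      rw [← hrz']; ring
    rw [this, hqe]
    ring
  rw [hexp, one_mul] at hJ
  push_cast at hJ
  linear_combination (1 / 2 : ℂ) * hJ

end

end

/-! ### The ring of modular forms as a domain of functions on the upper half plane. -/

section ModularForms

/-- Evaluation of modular forms at a point of the upper half plane. -/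
def modEval (τ : ℍ) : ModularFormRing →+* ℂ :=
  (Pi.evalRingHom (fun _ : ℍ => ℂ) τ).comp <| DirectSum.toSemiring
    (fun _ => { toFun := fun f τ => f τ, map_zero' := rfl, map_add' := fun _ _ => rfl })
    rfl (fun _ _ => rfl)

lemma modEval_of (τ : ℍ) {k : ℤ} (f : ModularForm 𝒮ℒ k) :
    modEval τ (DirectSum.of _ k f) = f τ := by
  exact congrFun (DirectSum.toAddMonoid_of (β := fun k => ModularForm 𝒮ℒ k) (γ := ℍ → ℂ)
    (fun _ => { toFun := fun f τ => f τ, map_zero' := rfl, map_add' := fun _ _ => rfl }) k f) τ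

lemma modularFormToFun_apply (L : Type*) [AddCommGroup L] (f : ModularFormRing) (τ : ℍ)
    (z : Cplx L) : modularFormToFun L f τ z = modEval τ f := by
  induction f using DirectSum.induction_on with
  | zero => simp
  | of k f =>
    rw [modEval_of]
    exact congrFun (congrFun (DirectSum.toAddMonoid_of (β := fun k => ModularForm 𝒮ℒ k)
      (γ := ℍ → Cplx L → ℂ)
      (fun _ => { toFun := fun f τ _ => f τ, map_zero' := rfl, map_add' := fun _ _ => rfl })
      k f) τ) z
  | add f g hf hg => rw [map_add, map_add, Pi.add_apply, Pi.add_apply, hf, hg]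

lemma differentiableOn_modEval (f : ModularFormRing) :
    DifferentiableOn ℂ (fun x => modEval (ofComplex x) f) {x | 0 < x.im} := by
  induction f using DirectSum.induction_on with
  | zero => simp
  | of k f =>
    simp only [modEval_of]
    exact mdifferentiable_iff.1 (ModularFormClass.holo f)
  | add f g hf hg =>
    simp only [map_add]
    exact hf.add hg

/-- After multiplication by a large power of the variable, a Laurent polynomial with infinitely many
nonzero zeros becomes a polynomial with infinitely many roots. -/
lemma eq_zero_of_forall_sum_zpow {x : ℕ → ℂ} (hx : (Set.range x).Infinite) (hx0 : ∀ n, x n ≠ 0)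
    (s : Finset ℤ) (a : ℤ → ℂ) (h : ∀ n, ∑ k ∈ s, a k * x n ^ k = 0) : ∀ k ∈ s, a k = 0 := by
  obtain ⟨N, hN⟩ : ∃ N : ℕ, ∀ k ∈ s, 0 ≤ k + N :=
    ⟨∑ k ∈ s, k.natAbs, fun k hk => by
      have := Finset.single_le_sum (f := fun k : ℤ => k.natAbs) (fun _ _ => Nat.zero_le _) hk
      omega⟩
  let p : Polynomial ℂ := ∑ k ∈ s, Polynomial.monomial (k + N).toNat (a k)
  have hroot : ∀ n, p.IsRoot (x n) := fun n => by
    rw [Polynomial.IsRoot, Polynomial.eval_finsetSum]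
    have : ∀ k ∈ s, Polynomial.eval (x n) (Polynomial.monomial (k + N).toNat (a k)) =
        a k * x n ^ k * x n ^ N := fun k hk => by
      rw [Polynomial.eval_monomial, mul_assoc, ← zpow_natCast (x n) N, ← zpow_add₀ (hx0 n),
        ← zpow_natCast, Int.toNat_of_nonneg (hN k hk)]
    rw [Finset.sum_congr rfl this, ← Finset.sum_mul, h, zero_mul]
  have hp : p = 0 := Polynomial.eq_zero_of_infinite_isRoot p
    (hx.mono (by rintro _ ⟨n, rfl⟩; exact hroot n))
  intro k hk
  have hc := congrArg (fun p => Polynomial.coeff p (k + N).toNat) hp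
  simp only [p, Polynomial.finsetSum_coeff, Polynomial.coeff_monomial, Polynomial.coeff_zero] at hc
  rwa [Finset.sum_eq_single_of_mem k hk fun k' hk' hne => if_neg fun heq => hne (by
    have h1 := hN k hk
    have h2 := hN k' hk'
    omega), if_pos rfl] at hc

/-- Modular forms of different weights are linearly independent: under the matrices `(1, 0; n, 1)`
the component of weight `k` is multiplied by `(nτ + 1) ^ k`, and these factors separate the weights.
-/
lemma modEval_eq_zero {f : ModularFormRing} (h : ∀ τ, modEval τ f = 0) : f = 0 := by
  classical
  ext k τ
  by_cases hk : k ∈ DFinsupp.support f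
  swap
  · rw [DFinsupp.notMem_support_iff.1 hk]
    rfl
  let γ : ℕ → SL(2, ℤ) := fun n => ⟨!![1, 0; (n : ℤ), 1], by simp⟩
  refine eq_zero_of_forall_sum_zpow (x := fun n => (n : ℂ) * τ + 1) ?_ (fun n => ?_)
    (DFinsupp.support f) (fun k => f k τ) (fun n => ?_) k hk
  · refine Set.infinite_range_of_injective fun n n' hnn' => ?_
    have h1 : (n : ℂ) * τ = n' * τ := add_right_cancel hnn'
    exact_mod_cast mul_right_cancel₀ τ.ne_zero h1
  · simpa [γ] using automorphyFactor_ne_zero (γ n) τ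
  · have h1 := h (γ n • τ)
    rw [← DirectSum.sum_support_of f, map_sum] at h1
    rw [← h1]
    refine Finset.sum_congr rfl fun k _ => ?_
    rw [modEval_of]
    have h2 : (f k) (γ n • τ) = denom (γ n) τ ^ k * (f k) τ :=
      SlashInvariantForm.slash_action_eqn'' (f k) (Γ := 𝒮ℒ)
        (γ := Matrix.SpecialLinearGroup.mapGL ℝ (γ n)) ⟨γ n, rfl⟩ τ
    rw [h2, ModularGroup.denom_apply]
    simp [γ, mul_comm]

instance : IsDomain ModularFormRing := by
  have : Nontrivial ModularFormRing := ⟨⟨0, 1, fun h => by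
    simpa using congrArg (modEval I) h⟩⟩
  have : NoZeroDivisors ModularFormRing := ⟨by
    intro f g hfg
    have hU : IsOpen {x : ℂ | 0 < x.im} := isOpen_lt continuous_const Complex.continuous_im
    have hC : Convex ℝ {x : ℂ | 0 < x.im} := convex_halfSpace_im_gt 0
    refine (eq_zero_or_eq_zero_of_mul_eqOn_zero hU hC (differentiableOn_modEval f)
      (differentiableOn_modEval g) fun x _ => by rw [← map_mul, hfg, map_zero]).imp
      (fun h => modEval_eq_zero fun τ => ?_) fun h => modEval_eq_zero fun τ => ?_
    · simpa using h τ τ.im_pos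
    · simpa using h τ τ.im_pos⟩
  exact NoZeroDivisors.to_isDomain _

end ModularForms

/-! ### Polynomials in Jacobi forms with modular forms as coefficients. -/

section Evaluation

variable {L : Type*} [AddCommGroup L] {J : Type*}

/-- The value at `(τ, z)` of a polynomial in functions `φ` with modular forms as coefficients. -/
def polyEval (φ : J → ℍ → Cplx L → ℂ) (P : MvPolynomial J ModularFormRing) (τ : ℍ) (z : Cplx L) :
    ℂ :=
  MvPolynomial.eval₂ (modEval τ) (fun j => φ j τ z) P

lemma algIndep_iff {n : ℕ} (φ : Fin n → ℍ → Cplx L → ℂ) :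
    AlgIndepOverModularForms φ ↔ ∀ P, polyEval φ P = 0 → P = 0 := by
  let := (modularFormToFun L).toAlgebra
  have h : ∀ P : MvPolynomial (Fin n) ModularFormRing, MvPolynomial.aeval φ P = polyEval φ P := by
    intro P
    ext τ z
    rw [MvPolynomial.aeval_def]
    let ev : (ℍ → Cplx L → ℂ) →+* ℂ :=
      (Pi.evalRingHom (fun _ : Cplx L => ℂ) z).comp (Pi.evalRingHom (fun _ : ℍ => Cplx L → ℂ) τ)
    have := MvPolynomial.eval₂_comp_left ev (algebraMap ModularFormRing (ℍ → Cplx L → ℂ)) φ P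
    refine this.trans ?_
    rw [polyEval]
    congr 1
    exact RingHom.ext fun f => modularFormToFun_apply L f τ z
  rw [AlgIndepOverModularForms, AlgebraicIndependent, injective_iff_map_eq_zero]
  simp only [h]

lemma isHolomorphic_polyEval {φ : J → ℍ → Cplx L → ℂ} (hφ : ∀ j, IsHolomorphic (φ j))
    (P : MvPolynomial J ModularFormRing) : IsHolomorphic (polyEval φ P) := by
  intro n b
  induction P using MvPolynomial.induction_on with
  | C f =>
    simp only [polyEval, MvPolynomial.eval₂_C]
    exact (differentiableOn_modEval f).comp differentiableOn_fst fun p hp => hp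
  | add P Q hP hQ =>
    simp only [polyEval, MvPolynomial.eval₂_add]
    exact hP.add hQ
  | mul_X P j hP =>
    simp only [polyEval, MvPolynomial.eval₂_mul, MvPolynomial.eval₂_X]
    exact hP.mul (hφ j n b)

lemma hasDerivAt_eval₂ {R : Type*} [CommRing R] [Fintype J] (f : R →+* ℂ) (x : J → ℂ → ℂ)
    (x' : J → ℂ) (s : ℂ) (hx : ∀ j, HasDerivAt (x j) (x' j) s) (P : MvPolynomial J R) :
    HasDerivAt (fun s => MvPolynomial.eval₂ f (fun j => x j s) P)
      (∑ j, MvPolynomial.eval₂ f (fun j => x j s) (MvPolynomial.pderiv j P) * x' j) s := by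
  classical
  induction P using MvPolynomial.induction_on with
  | C a => simpa using hasDerivAt_const s (f a)
  | add P Q hP hQ =>
    simp only [MvPolynomial.eval₂_add, map_add, add_mul, Finset.sum_add_distrib]
    exact hP.add hQ
  | mul_X P i hP =>
    simp only [MvPolynomial.eval₂_mul, MvPolynomial.eval₂_X]
    refine (hP.fun_mul (hx i)).congr_deriv ?_
    simp only [Derivation.leibniz, MvPolynomial.pderiv_X, smul_eq_mul, MvPolynomial.eval₂_add,
      MvPolynomial.eval₂_mul, MvPolynomial.eval₂_X, add_mul, Finset.sum_add_distrib]
    rw [add_comm]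
    congr 1
    · rw [Finset.sum_eq_single i]
      · simp
      · intro j _ hj
        simp [hj.symm]
      · simp
    · rw [Finset.sum_mul]
      exact Finset.sum_congr rfl fun j _ => by ring

lemma eval₂_weightedHomogeneous {R : Type*} [CommRing R] {m : J → ℕ} {N : ℕ}
    {P : MvPolynomial J R} (hP : P.IsWeightedHomogeneous m N) (f : R →+* ℂ) (y : J → ℂ) (e : ℂ) :
    MvPolynomial.eval₂ f (fun j => e ^ m j * y j) P = e ^ N * MvPolynomial.eval₂ f y P := by
  rw [MvPolynomial.eval₂_eq, MvPolynomial.eval₂_eq, Finset.mul_sum]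
  refine Finset.sum_congr rfl fun d hd => ?_
  have hw := hP (MvPolynomial.mem_support_iff.1 hd)
  rw [Finsupp.weight_apply, Finsupp.sum] at hw
  have h1 : ∏ j ∈ d.support, (e ^ m j * y j) ^ d j = e ^ N * ∏ j ∈ d.support, y j ^ d j := by
    simp only [mul_pow, Finset.prod_mul_distrib, ← pow_mul]
    rw [Finset.prod_pow_eq_pow_sum, ← hw]
    congr 2
    exact Finset.sum_congr rfl fun j _ => by rw [smul_eq_mul, mul_comm]
  rw [h1]
  ring

end Evaluation

/-! ### A nonzero Jacobian implies algebraic independence. -/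

section Independence

variable {L : Type*} [AddCommGroup L] {B : LinearMap.BilinForm ℤ L}
  {G : Subgroup (L ≃ₗ[ℤ] L)} {J : Type*}

/-- The norms are `exp (π (n² (x, x) Im τ + 2 n Im (x, z)))`, unbounded in `n` by positive
definiteness. -/
lemma infinite_range_quasiPeriod (hB : IsEvenPosDef B) {x : L} (hx : x ≠ 0) (τ : ℍ) (z : Cplx L) :
    (Set.range fun n : ℕ => Complex.exp (-(Real.pi * Complex.I *
      (cform B (incl (n • x)) (incl (n • x)) * τ + 2 * cform B (incl (n • x)) z)))).Infinite := by
  intro hfin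
  have hincl : ∀ n : ℕ, incl (n • x) = (n : ℂ) • incl x := fun n => by
    simp [incl, Nat.cast_smul_eq_nsmul]
  set q : ℝ := ((B x x : ℤ) : ℝ) with hq
  have hqpos : 0 < q := Int.cast_pos.2 (hB.posDef x hx)
  set w := cform B (incl x) z
  have hre : ∀ n : ℕ, (-(Real.pi * Complex.I *
      (cform B (incl (n • x)) (incl (n • x)) * τ + 2 * cform B (incl (n • x)) z))).re =
      n * (Real.pi * (n * (q * τ.im) + 2 * w.im)) := by
    intro n
    have h1 : cform B (incl (n • x)) (incl (n • x)) = ((n * n * q : ℝ) : ℂ) := by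
      rw [hincl]
      simp only [map_smul, LinearMap.smul_apply, smul_eq_mul, cform_incl, hq]
      push_cast
      ring
    have h2 : cform B (incl (n • x)) z = ((n : ℝ) : ℂ) * w := by
      rw [hincl]
      simp [w]
    rw [h1, h2]
    simp
    ring
  obtain ⟨C, hC⟩ := (hfin.image norm).bddAbove
  have hlim : Filter.Tendsto (fun n : ℕ => (n : ℝ) * (Real.pi * (n * (q * τ.im) + 2 * w.im)))
      Filter.atTop Filter.atTop := by
    have h1 : Filter.Tendsto (fun n : ℕ => (n : ℝ)) Filter.atTop Filter.atTop :=
      tendsto_natCast_atTop_atTop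
    refine h1.atTop_mul_atTop₀ (Filter.Tendsto.const_mul_atTop Real.pi_pos ?_)
    exact Filter.tendsto_atTop_add_const_right _ _
      (h1.atTop_mul_const (mul_pos hqpos τ.im_pos))
  have hlim2 := Real.tendsto_exp_atTop.comp hlim
  obtain ⟨n, hn⟩ := (hlim2.eventually (Filter.eventually_gt_atTop C)).exists
  refine absurd (hC ⟨_, ⟨n, rfl⟩, rfl⟩) (not_le.2 ?_)
  rw [Complex.norm_exp, hre]
  exact hn

/-- Polynomial relations between Jacobi forms are sums of relations homogeneous in the index. -/
lemma polyEval_weightedHomogeneousComponent (hB : IsEvenPosDef B) [Nontrivial L] {k : J → ℤ}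
    {m : J → ℕ} {φ : J → ℍ → Cplx L → ℂ} (hφ : ∀ j, IsWeakJacobiForm B G (k j) (m j) (φ j))
    {P : MvPolynomial J ModularFormRing} (hP : polyEval φ P = 0) (N : ℕ) :
    polyEval φ (MvPolynomial.weightedHomogeneousComponent m N P) = 0 := by
  classical
  obtain ⟨x, hx⟩ := exists_ne (0 : L)
  ext τ z
  set e : ℕ → ℂ := fun n => Complex.exp (-(Real.pi * Complex.I *
      (cform B (incl (n • x)) (incl (n • x)) * τ + 2 * cform B (incl (n • x)) z))) with he
  -- Translation by `n x τ` multiplies a form of index `t` by the `t`-th power of one number `e n`,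
  -- so the infinitely many values of `e` separate the indices.
  have hφe : ∀ n j, φ j τ (z + (τ : ℂ) • incl (n • x) + incl 0) = e n ^ m j * φ j τ z := by
    intro n j
    rw [(hφ j).quasiPeriodic, he]
    simp only
    rw [← Complex.exp_nat_mul]
    congr 2
    ring
  have hfs := MvPolynomial.weightedHomogeneousComponent_finsupp (w := m) P
  set S := hfs.toFinset with hS
  have hPsum : ∑ N ∈ S, MvPolynomial.weightedHomogeneousComponent m N P = P := by
    rw [← finsum_eq_sum _ hfs, MvPolynomial.sum_weightedHomogeneousComponent]
  set c : ℕ → ℂ := fun N => polyEval φ (MvPolynomial.weightedHomogeneousComponent m N P) τ z with hc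
  have hrel : ∀ n, ∑ N ∈ S, c N * e n ^ N = 0 := by
    intro n
    have h1 : polyEval φ P τ (z + (τ : ℂ) • incl (n • x) + incl 0) = 0 := by rw [hP]; rfl
    rw [← hPsum, polyEval, MvPolynomial.eval₂_sum] at h1
    simp only [hφe] at h1
    rw [← h1]
    refine Finset.sum_congr rfl fun N _ => ?_
    rw [eval₂_weightedHomogeneous
      (MvPolynomial.weightedHomogeneousComponent_isWeightedHomogeneous N P)]
    exact mul_comm _ _
  by_cases hN : N ∈ S
  · have h2 := eq_zero_of_forall_sum_zpow (x := e) (infinite_range_quasiPeriod hB hx τ z)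
      (fun n => Complex.exp_ne_zero _) (S.map Nat.castEmbedding) (fun k => c k.toNat) (fun n => by
        rw [Finset.sum_map]
        simpa using hrel n) N (by simpa using hN)
    simpa using h2
  · have : MvPolynomial.weightedHomogeneousComponent m N P = 0 := by
      by_contra h
      exact hN ((Set.Finite.mem_toFinset _).2 h)
    rw [this]
    simp [polyEval]

variable [Module.Finite ℤ L]

/-- Row 0 of the matrix annihilates the vector of partial derivatives by Euler's identity, the other
rows by the chain rule. Multiplying by the adjugate gives `J · ∂P/∂X_j(φ) = 0`, and holomorphic
functions have no zero divisors. -/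
lemma pderiv_relation {l : ℕ} (b : Module.Basis (Fin l) ℂ (Cplx L)) {m : Fin (l + 1) → ℕ}
    {φ : Fin (l + 1) → ℍ → Cplx L → ℂ} (hφ : ∀ j, IsHolomorphic (φ j))
    (hJ : jacobian b m φ ≠ 0) {P : MvPolynomial (Fin (l + 1)) ModularFormRing} {N : ℕ}
    (hP : P.IsWeightedHomogeneous m N) (hP0 : polyEval φ P = 0) (j : Fin (l + 1)) :
    polyEval φ (MvPolynomial.pderiv j P) = 0 := by
  have hker : ∀ τ z, Matrix.mulVec (jacobianMatrix b m φ τ z)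
      (fun j => polyEval φ (MvPolynomial.pderiv j P) τ z) = 0 := by
    intro τ z
    ext i
    simp only [Matrix.mulVec, dotProduct, Pi.zero_apply]
    refine Fin.cases ?_ (fun i => ?_) i
    · have h := congrArg (MvPolynomial.eval₂ (modEval τ) (fun j => φ j τ z))
        hP.sum_weight_X_mul_pderiv
      have h0 : MvPolynomial.eval₂ (modEval τ) (fun j => φ j τ z) P = 0 :=
        congrFun (congrFun hP0 τ) z
      simp only [MvPolynomial.eval₂_sum, nsmul_eq_mul, MvPolynomial.eval₂_mul,
        MvPolynomial.eval₂_natCast, MvPolynomial.eval₂_X, h0, mul_zero] at h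
      rw [← h]
      refine Finset.sum_congr rfl fun j _ => ?_
      simp only [jacobianMatrix, Matrix.of_apply, Fin.cons_zero, polyEval]
      ring
    · have h := hasDerivAt_eval₂ (modEval τ) (fun j s => φ j τ (z + s • b i)) _ 0
        (fun j => (hφ j).hasDerivAt_dirDeriv τ z (b i)) P
      have h1 : (fun s : ℂ => MvPolynomial.eval₂ (modEval τ) (fun j => φ j τ (z + s • b i)) P) =
          fun _ => 0 := by
        ext s
        exact congrFun (congrFun hP0 τ) (z + s • b i)
      rw [h1] at h
      have h2 := h.unique (hasDerivAt_const 0 0)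
      simp only [zero_smul, add_zero] at h2
      rw [← h2]
      refine Finset.sum_congr rfl fun j _ => ?_
      simp only [jacobianMatrix, Matrix.of_apply, Fin.cons_succ, polyEval, partialZ_eq_dirDeriv]
      ring
  have hprod : ∀ τ z, jacobian b m φ τ z * polyEval φ (MvPolynomial.pderiv j P) τ z = 0 := by
    intro τ z
    have h := congrArg (Matrix.mulVec (jacobianMatrix b m φ τ z).adjugate) (hker τ z)
    rw [Matrix.mulVec_mulVec, Matrix.adjugate_mul, Matrix.smul_mulVec, Matrix.one_mulVec,
      Matrix.mulVec_zero] at h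
    exact congrFun h j
  rcases eq_zero_or_eq_zero_of_mul_eqOn_zero (isOpen_halfPlane_prod l) (convex_halfPlane_prod l)
    (isHolomorphic_jacobian b m hφ l b)
    (isHolomorphic_polyEval hφ (MvPolynomial.pderiv j P) l b) (fun p _ => hprod _ _) with h | h
  · refine absurd ?_ hJ
    ext τ z
    have := h ((τ : ℂ), b.equivFun z) τ.im_pos
    simpa [b.sum_repr] using this
  · ext τ z
    have := h ((τ : ℂ), b.equivFun z) τ.im_pos
    simpa [b.sum_repr] using this

/-- Induction on the degree: the partial derivatives of each homogeneous component are relations of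
lower degree, hence zero. In characteristic zero the component is then constant, and a constant
relation is trivial. -/
lemma algIndep_of_jacobian_ne_zero (hB : IsEvenPosDef B) [Nontrivial L] {l : ℕ}
    (b : Module.Basis (Fin l) ℂ (Cplx L)) {k : Fin (l + 1) → ℤ} {m : Fin (l + 1) → ℕ}
    {φ : Fin (l + 1) → ℍ → Cplx L → ℂ} (hφ : ∀ j, IsWeakJacobiForm B G (k j) (m j) (φ j))
    (hJ : jacobian b m φ ≠ 0) : AlgIndepOverModularForms φ := by
  classical
  rw [algIndep_iff]
  suffices h : ∀ (d : ℕ) (P : MvPolynomial (Fin (l + 1)) ModularFormRing),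
      (∀ α, P.coeff α ≠ 0 → α.degree ≤ d) → polyEval φ P = 0 → P = 0 from
    fun P hP => h (P.support.sup Finsupp.degree) P (fun α hα =>
      Finset.le_sup (f := Finsupp.degree) (MvPolynomial.mem_support_iff.2 hα)) hP
  have hconst : ∀ P : MvPolynomial (Fin (l + 1)) ModularFormRing,
      (∀ α, P.coeff α ≠ 0 → α.degree ≤ 0) → polyEval φ P = 0 → P = 0 := by
    intro P hd hP
    have hPC : P = MvPolynomial.C (P.coeff 0) := by
      refine MvPolynomial.ext _ _ fun α => ?_
      rw [MvPolynomial.coeff_C]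
      split_ifs with h
      · rw [h]
      · by_contra hne
        exact h ((Finsupp.degree_eq_zero_iff _).1 (Nat.le_zero.1 (hd α hne))).symm
    have h0 : P.coeff 0 = 0 := modEval_eq_zero fun τ => by
      have := congrFun (congrFun hP τ) 0
      rw [hPC, polyEval, MvPolynomial.eval₂_C] at this
      exact this
    rw [hPC, h0, map_zero]
  intro d
  induction d with
  | zero => exact hconst
  | succ d ih =>
    intro P hd hP
    have hcomp : ∀ N, MvPolynomial.weightedHomogeneousComponent m N P = 0 := by
      intro N
      set Q := MvPolynomial.weightedHomogeneousComponent m N P with hQ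
      have hQP : ∀ α, Q.coeff α ≠ 0 → P.coeff α ≠ 0 := fun α hα h0 => hα (by
        rw [hQ, MvPolynomial.coeff_weightedHomogeneousComponent, h0, ite_self])
      have hQ0 := polyEval_weightedHomogeneousComponent hB hφ hP N
      have hder : ∀ j, MvPolynomial.pderiv j Q = 0 := fun j => by
        refine ih _ (fun α hα => ?_) (pderiv_relation b (fun j => (hφ j).holomorphic) hJ
          (MvPolynomial.weightedHomogeneousComponent_isWeightedHomogeneous N P) hQ0 j)
        rw [MvPolynomial.coeff_pderiv] at hα
        have := hd _ (hQP _ (left_ne_zero_of_mul hα))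
        rw [map_add, Finsupp.degree_single] at this
        omega
      refine hconst Q (fun α hα => ?_) hQ0
      by_contra hdeg
      have hα0 : α ≠ 0 := fun h => hdeg (by simp [h])
      obtain ⟨j, hj⟩ := Finsupp.ne_iff.1 hα0
      have hle : Finsupp.single j 1 ≤ α := by
        rw [Finsupp.single_le_iff]
        exact Nat.one_le_iff_ne_zero.2 hj
      have h1 := congrArg (MvPolynomial.coeff (α - Finsupp.single j 1)) (hder j)
      rw [MvPolynomial.coeff_pderiv, tsub_add_cancel_of_le hle, MvPolynomial.coeff_zero] at h1
      refine hα (modEval_eq_zero fun τ => ?_)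
      have h2 := congrArg (modEval τ) h1
      rw [map_mul, map_zero, map_add, map_natCast, map_one] at h2
      exact (mul_eq_zero.1 h2).resolve_right (Nat.cast_add_one_ne_zero _)
    rw [← MvPolynomial.sum_weightedHomogeneousComponent m P]
    simp [hcomp]

end Independence

/-! ### The twist by `E₂`: Taylor coefficients of weak Jacobi forms are modular forms. -/

section

variable {L : Type*} [AddCommGroup L]

section Algebra

variable {B : LinearMap.BilinForm ℤ L} {G : Subgroup (L ≃ₗ[ℤ] L)}

lemma isWeakJacobiForm_one : IsWeakJacobiForm B G 0 0 fun _ _ => 1 where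
  holomorphic _ _ := differentiableOn_const _
  modular γ τ z := by simp
  quasiPeriodic x y τ z := by simp
  fourier := by
    obtain ⟨f, hf⟩ := HasFourier.const (B := B) 1
    exact ⟨fun n ℓ => f (n, ℓ), hf⟩
  invariant _ _ _ _ := rfl

lemma IsWeakJacobiForm.mul {k₁ k₂ : ℤ} {t₁ t₂ : ℕ} {φ ψ : ℍ → Cplx L → ℂ}
    (hφ : IsWeakJacobiForm B G k₁ t₁ φ) (hψ : IsWeakJacobiForm B G k₂ t₂ ψ) :
    IsWeakJacobiForm B G (k₁ + k₂) (t₁ + t₂) fun τ z => φ τ z * ψ τ z where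
  holomorphic n b := (hφ.holomorphic n b).mul (hψ.holomorphic n b)
  modular γ τ z := by
    rw [hφ.modular, hψ.modular, zpow_add₀ (automorphyFactor_ne_zero γ τ)]
    push_cast
    rw [add_mul, add_mul, add_mul, Complex.exp_add]
    ring
  quasiPeriodic x y τ z := by
    rw [hφ.quasiPeriodic, hψ.quasiPeriodic]
    push_cast
    rw [add_mul, add_mul, add_mul, neg_add, Complex.exp_add]
    ring
  fourier := by
    obtain ⟨f, hf⟩ := hφ.hasFourier.mul hψ.hasFourier
    exact ⟨fun n ℓ => f (n, ℓ), hf⟩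
  invariant σ hσ τ z := by rw [hφ.invariant σ hσ, hψ.invariant σ hσ]

lemma IsWeakJacobiForm.pow {k : ℤ} {t : ℕ} {φ : ℍ → Cplx L → ℂ}
    (hφ : IsWeakJacobiForm B G k t φ) (a : ℕ) :
    IsWeakJacobiForm B G (a * k) (a * t) fun τ z => φ τ z ^ a := by
  induction a with
  | zero => simpa using isWeakJacobiForm_one
  | succ a ih => simpa only [Nat.cast_succ, Nat.succ_mul, add_mul, one_mul, pow_succ] using ih.mul hφ

lemma IsWeakJacobiForm.prod_pow {J : Type*} {k : J → ℤ} {t : J → ℕ} {φ : J → ℍ → Cplx L → ℂ}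
    (hφ : ∀ j, IsWeakJacobiForm B G (k j) (t j) (φ j)) (a : J → ℕ) (s : Finset J) :
    IsWeakJacobiForm B G (∑ j ∈ s, a j * k j) (∑ j ∈ s, a j * t j)
      fun τ z => ∏ j ∈ s, φ j τ z ^ a j := by
  classical
  induction s using Finset.induction_on with
  | empty => simpa using isWeakJacobiForm_one
  | insert j s hj ih =>
    simp only [Finset.sum_insert hj, Finset.prod_insert hj]
    exact ((hφ j).pow (a j)).mul ih

end Algebra

section Heat

variable (B : LinearMap.BilinForm ℤ L)

/-- The function `φ`, of index `t`, multiplied by the exponential which makes the exponential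
factor in its transformation under the modular group disappear. -/
def heatTwist (t : ℕ) (φ : ℍ → Cplx L → ℂ) : ℍ → Cplx L → ℂ :=
  fun τ z => Complex.exp (t * Real.pi ^ 2 / 6 * EisensteinSeries.E2 τ * cform B z z) * φ τ z

variable {B}

lemma E2_smul (γ : SL(2, ℤ)) (τ : ℍ) :
    EisensteinSeries.E2 (γ • τ) = ((γ 1 0 : ℂ) * τ + (γ 1 1 : ℂ)) ^ 2 * EisensteinSeries.E2 τ -
      6 * Complex.I / Real.pi * γ 1 0 * ((γ 1 0 : ℂ) * τ + (γ 1 1 : ℂ)) := by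
  have hne := automorphyFactor_ne_zero γ τ
  have h := congrFun (EisensteinSeries.E2_slash_action γ) τ
  rw [ModularForm.SL_slash_apply, Pi.sub_apply, Pi.smul_apply, EisensteinSeries.D2,
    ModularGroup.denom_apply, riemannZeta_two, smul_eq_mul] at h
  have hpi : (Real.pi : ℂ) ≠ 0 := by exact_mod_cast Real.pi_ne_zero
  rw [zpow_neg, ← div_eq_mul_inv, div_eq_iff (zpow_ne_zero _ hne)] at h
  rw [h]
  rw [show ((2 : ℤ)) = ((2 : ℕ) : ℤ) from rfl, zpow_natCast]
  field_simp

/-- The anomaly of `E₂`, multiplied by `(t π² / 6) (z, z) / (cτ + d)²`, is exactly `-t π i c (z, z)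
/ (cτ + d)`, which cancels the exponent in the law of `φ`. -/
lemma IsWeakJacobiForm.heatTwist_modular {G : Subgroup (L ≃ₗ[ℤ] L)} {k : ℤ} {t : ℕ}
    {φ : ℍ → Cplx L → ℂ} (hφ : IsWeakJacobiForm B G k t φ) (γ : SL(2, ℤ)) (τ : ℍ) (z : Cplx L) :
    heatTwist B t φ (γ • τ) (((γ 1 0 : ℂ) * τ + (γ 1 1 : ℂ))⁻¹ • z) =
      ((γ 1 0 : ℂ) * τ + (γ 1 1 : ℂ)) ^ k * heatTwist B t φ τ z := by
  have hne := automorphyFactor_ne_zero γ τ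
  have hpi : (Real.pi : ℂ) ≠ 0 := by exact_mod_cast Real.pi_ne_zero
  simp only [heatTwist]
  rw [hφ.modular, E2_smul]
  simp only [map_smul, LinearMap.smul_apply, smul_eq_mul]
  set j := (γ 1 0 : ℂ) * τ + (γ 1 1 : ℂ)
  have h : ∀ x y u p q : ℂ, x + y = u → Complex.exp x * (p * Complex.exp y * q) =
      p * (Complex.exp u * q) := by
    rintro x y u p q rfl
    rw [Complex.exp_add]
    ring
  refine h _ _ _ _ _ ?_
  field_simp
  ring

lemma isHolomorphic_heatTwist (t : ℕ) {φ : ℍ → Cplx L → ℂ} (hφ : IsHolomorphic φ) :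
    IsHolomorphic (heatTwist B t φ) := by
  intro n b
  refine DifferentiableOn.mul (DifferentiableOn.cexp ?_) (hφ n b)
  have hE : DifferentiableOn ℂ (fun p : ℂ × (Fin n → ℂ) => EisensteinSeries.E2 (ofComplex p.1))
      {p | 0 < p.1.im} :=
    (UpperHalfPlane.mdifferentiable_iff.1 E2_mdifferentiable).comp
      (g := EisensteinSeries.E2 ∘ ofComplex) differentiableOn_fst fun p hp => hp
  refine (hE.const_mul _).mul (Differentiable.differentiableOn ?_)
  simp only [map_sum, map_smul, LinearMap.sum_apply, LinearMap.smul_apply, smul_eq_mul]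
  fun_prop

lemma iteratedDeriv_line (F : ℍ → Cplx L → ℂ) (τ : ℍ) (w : Cplx L) (d : ℕ) :
    iteratedDeriv d (fun s : ℂ => F τ (s • w)) = fun s => (dirDeriv w)^[d] F τ (s • w) := by
  induction d with
  | zero => rfl
  | succ d ih =>
    ext s
    rw [iteratedDeriv_succ, ih, Function.iterate_succ_apply']
    have h := deriv_comp_const_add (fun u : ℂ => (dirDeriv w)^[d] F τ (u • w)) s 0
    rw [add_zero] at h
    rw [← h, dirDeriv]
    simp only [add_smul]

lemma IsHolomorphic.iterate_dirDeriv {F : ℍ → Cplx L → ℂ} (hF : IsHolomorphic F) (w : Cplx L)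
    (d : ℕ) : IsHolomorphic ((LatticeJacobi.dirDeriv w)^[d] F) := by
  induction d with
  | zero => exact hF
  | succ d ih =>
    rw [Function.iterate_succ_apply']
    exact ih.dirDeriv w

/-- The `d`-th Taylor coefficient (without the factorial) at `z = 0` in the direction `w`. -/
def taylorCoeff (F : ℍ → Cplx L → ℂ) (d : ℕ) (w : Cplx L) (τ : ℍ) : ℂ :=
  iteratedDeriv d (fun s : ℂ => F τ (s • w)) 0

lemma IsHolomorphic.differentiable_line [Module.Finite ℤ L] {F : ℍ → Cplx L → ℂ}
    (hF : IsHolomorphic F) (τ : ℍ) (w : Cplx L) : Differentiable ℂ fun s : ℂ => F τ (s • w) := by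
  have b := Module.finBasis ℂ (Cplx L)
  have h := (hF.differentiable_sliceFun b τ).comp
    (by fun_prop : Differentiable ℂ fun s : ℂ => s • b.equivFun w)
  refine (congrArg (Differentiable ℂ) (funext fun s => ?_)).mp h
  rw [Function.comp_apply, sliceFun, ← map_smul, b.sum_equivFun]

lemma mdifferentiable_taylorCoeff [Module.Finite ℤ L] {F : ℍ → Cplx L → ℂ}
    (hF : IsHolomorphic F) (d : ℕ) (w : Cplx L) :
    DifferentiableOn ℂ (taylorCoeff F d w ∘ ofComplex) {τ | 0 < τ.im} := by
  have b := Module.finBasis ℂ (Cplx L)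
  have h := (hF.iterate_dirDeriv w d _ b).comp (s := {τ : ℂ | 0 < τ.im})
    (f := fun τ : ℂ => (τ, (0 : Fin _ → ℂ)))
    (Differentiable.differentiableOn (by fun_prop)) fun τ hτ => hτ
  refine h.congr fun τ _ => ?_
  simp [taylorCoeff, iteratedDeriv_line]

/-- Rescaling `z` by the automorphy factor makes each of the `d` derivatives raise the weight by
one. -/
lemma taylorCoeff_smul {F : ℍ → Cplx L → ℂ} {k : ℤ}
    (hF : ∀ (γ : SL(2, ℤ)) (τ : ℍ) (z : Cplx L),
      F (γ • τ) (((γ 1 0 : ℂ) * τ + (γ 1 1 : ℂ))⁻¹ • z) =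
        ((γ 1 0 : ℂ) * τ + (γ 1 1 : ℂ)) ^ k * F τ z) [Module.Finite ℤ L] (hF' : IsHolomorphic F)
    (d : ℕ) (w : Cplx L) (γ : SL(2, ℤ)) (τ : ℍ) :
    taylorCoeff F d w (γ • τ) =
      ((γ 1 0 : ℂ) * τ + (γ 1 1 : ℂ)) ^ (k + d) * taylorCoeff F d w τ := by
  have hne := automorphyFactor_ne_zero γ τ
  set j := (γ 1 0 : ℂ) * τ + (γ 1 1 : ℂ) with hj
  have h1 : (fun s : ℂ => F (γ • τ) (s • w)) = fun s => j ^ k * F τ ((j * s) • w) := by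
    ext s
    rw [← hF γ τ, smul_smul, inv_mul_cancel_left₀ hne]
  have hd := hF'.differentiable_line τ w
  rw [taylorCoeff, h1, iteratedDeriv_const_mul_field]
  have h2 := congrFun (iteratedDeriv_comp_const_mul (n := d) (f := fun s : ℂ => F τ (s • w))
    hd.contDiff j) 0
  rw [h2, mul_zero, zpow_add₀ hne, zpow_natCast, taylorCoeff, mul_assoc]

/-- Only exponents `n ≥ 0` of `q` occur, so for `Im τ ≥ 1` the series is dominated by its majorant
at `τ = i`. -/
lemma HasFourier.exists_bound {φ : ℍ → Cplx L → ℂ} (hφ : HasFourier B φ) (w : Cplx L) :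
    ∃ M, ∀ (τ : ℍ) (s : ℂ), 1 ≤ τ.im → ‖s‖ ≤ 1 → ‖φ τ (s • w)‖ ≤ M := by
  obtain ⟨f, hf⟩ := hφ
  have hs := HasFourier.summable_norm_mul_exp hf I 0 w
  refine ⟨_, fun τ s hτ hs1 => (hf τ (s • w)).norm_le_of_bounded hs.hasSum fun p => ?_⟩
  have h0 := fourierExp_add_smul (B := B) τ 0 w s p
  rw [zero_add] at h0
  rw [h0, ← mul_assoc, norm_mul, norm_mul, norm_mul]
  have h1 : ‖fourierExp B τ 0 p‖ ≤ ‖fourierExp B I 0 p‖ := by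
    simp only [fourierExp, Complex.norm_exp, map_zero, add_zero]
    refine Real.exp_le_exp.2 ?_
    simp
    gcongr
    exact le_mul_of_one_le_right (Nat.cast_nonneg _) hτ
  have h2 : ‖Complex.exp (s * (2 * Real.pi * Complex.I * cform B (p.2 : Cplx L) w))‖ ≤
      Real.exp ‖2 * Real.pi * Complex.I * cform B (p.2 : Cplx L) w‖ := by
    refine (Complex.norm_exp_le_exp_norm _).trans (Real.exp_le_exp.2 ?_)
    rw [norm_mul]
    exact mul_le_of_le_one_left (norm_nonneg _) hs1
  gcongr

lemma isBoundedAtImInfty_taylorCoeff [Module.Finite ℤ L] {φ : ℍ → Cplx L → ℂ}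
    (hφ : HasFourier B φ) (hφ' : IsHolomorphic φ) (t d : ℕ) (w : Cplx L) :
    IsBoundedAtImInfty (taylorCoeff (heatTwist B t φ) d w) := by
  obtain ⟨M, hM⟩ := hφ.exists_bound w
  obtain ⟨M', A, hM'⟩ := isBoundedAtImInfty_iff.1 EisensteinSeries.isBoundedAtImInfty_E2
  rw [isBoundedAtImInfty_iff]
  refine ⟨d.factorial * (Real.exp (‖(t * Real.pi ^ 2 / 6 : ℂ)‖ * M' * ‖cform B w w‖) * M) / 1 ^ d,
    max 1 A, fun τ hτ => ?_⟩
  refine Complex.norm_iteratedDeriv_le_of_forall_mem_sphere_norm_le d one_pos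
    ((isHolomorphic_heatTwist t hφ').differentiable_line τ w).diffContOnCl fun s hs => ?_
  have hs1 : ‖s‖ = 1 := by simpa using hs
  rw [heatTwist, norm_mul]
  refine mul_le_mul ((Complex.norm_exp_le_exp_norm _).trans (Real.exp_le_exp.2 ?_))
    (hM τ s (le_trans (le_max_left _ _) hτ) hs1.le) (norm_nonneg _) (Real.exp_pos _).le
  simp only [map_smul, LinearMap.smul_apply, smul_eq_mul, norm_mul, hs1, one_mul]
  gcongr
  exact hM' τ (le_trans (le_max_right _ _) hτ)

/-- The Taylor coefficients of the twist of a weak Jacobi form are modular forms. -/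
lemma IsWeakJacobiForm.exists_modularForm [Module.Finite ℤ L] {G : Subgroup (L ≃ₗ[ℤ] L)} {k : ℤ}
    {t : ℕ} {φ : ℍ → Cplx L → ℂ} (hφ : IsWeakJacobiForm B G k t φ) (d : ℕ) (w : Cplx L) :
    ∃ f : ModularFormRing, ∀ τ, modEval τ f = taylorCoeff (heatTwist B t φ) d w τ := by
  have hslash : ∀ γ : SL(2, ℤ), taylorCoeff (heatTwist B t φ) d w ∣[k + (d : ℤ)] γ =
      taylorCoeff (heatTwist B t φ) d w := by
    intro γ
    ext τ
    have hne := automorphyFactor_ne_zero γ τ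
    rw [ModularForm.SL_slash_apply, ModularGroup.denom_apply,
      taylorCoeff_smul hφ.heatTwist_modular (isHolomorphic_heatTwist t hφ.holomorphic), zpow_neg,
      mul_comm, inv_mul_cancel_left₀ (zpow_ne_zero _ hne)]
  let g : ModularForm 𝒮ℒ (k + d) :=
    { toFun := taylorCoeff (heatTwist B t φ) d w
      slash_action_eq' := by
        rintro _ ⟨γ, rfl⟩
        exact hslash γ
      holo' := UpperHalfPlane.mdifferentiable_iff.2
        (mdifferentiable_taylorCoeff (isHolomorphic_heatTwist t hφ.holomorphic) d w)
      -- Invariance under the full modular group reduces every cusp to `i∞`.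
      bdd_at_cusps' := fun {c} hc => by
        rw [OnePoint.isBoundedAt_iff_forall_SL2Z hc]
        intro γ _
        rw [hslash]
        exact isBoundedAtImInfty_taylorCoeff hφ.hasFourier hφ.holomorphic t d w }
  exact ⟨DirectSum.of _ _ g, fun τ => modEval_of τ g⟩

end Heat

end

/-! ### From relations at each point of `ℍ` to relations over modular forms. -/

section

/-- Over a domain, the columns of a matrix with finitely many columns are linearly dependent
unless some maximal minor is nonzero. -/
lemma exists_relation_or_det_ne_zero {A I R : Type*} [CommRing A] [IsDomain A] [Fintype I]
    [DecidableEq I] (M : R → I → A) :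
    (∃ c : I → A, c ≠ 0 ∧ ∀ r, ∑ i, c i * M r i = 0) ∨
      ∃ ρ : I → R, (Matrix.of fun i j => M (ρ i) j).det ≠ 0 := by
  let K := FractionRing A
  have hinj : Function.Injective (algebraMap A K) := IsFractionRing.injective A K
  let v : R → I → K := fun r i => algebraMap A K (M r i)
  -- If the rows do not span `K ^ I`, a nonzero functional kills them all, and clearing denominators
  -- gives the relation; if they span, a basis chosen among them gives the minor.
  rcases (le_top : Submodule.span K (Set.range v) ≤ ⊤).lt_or_eq with hlt | htop
  · left
    obtain ⟨f, hf0, hf⟩ := Submodule.exists_le_ker_of_lt_top _ hlt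
    obtain ⟨β, hβ⟩ := IsLocalization.exist_integer_multiples_of_finite (nonZeroDivisors A)
      fun i => f (Pi.single i (1 : K))
    choose c hc using hβ
    have hβ0 : algebraMap A K β ≠ 0 := fun h =>
      nonZeroDivisors.coe_ne_zero β (hinj (h.trans (map_zero _).symm))
    refine ⟨c, fun h0 => hf0 ?_, fun r => hinj ?_⟩
    · refine (Pi.basisFun K I).ext fun i => ?_
      have h := hc i
      rw [h0, Pi.zero_apply, map_zero, Algebra.smul_def] at h
      simpa [hβ0] using h.symm
    · have h1 : f (v r) = 0 := hf (Submodule.subset_span ⟨r, rfl⟩)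
      have h2 : f (v r) = ∑ i, v r i * f (Pi.single i 1) := by
        refine (LinearMap.pi_apply_eq_sum_univ f (v r)).trans (Finset.sum_congr rfl fun i _ => ?_)
        rw [smul_eq_mul]
        congr 2
        ext k
        simp [Pi.single_apply, eq_comm]
      rw [map_sum, map_zero, ← mul_zero (algebraMap A K β), ← h1, h2, Finset.mul_sum]
      refine Finset.sum_congr rfl fun i _ => ?_
      rw [map_mul, hc, Algebra.smul_def]
      ring
  · right
    obtain ⟨t, htv, htspan, htli⟩ := exists_linearIndependent K (Set.range v)
    rw [htop] at htspan
    let e : Module.Basis t K (I → K) := Module.Basis.mk htli (by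
      rw [Subtype.range_coe, htspan])
    let σ : I ≃ t := (Pi.basisFun K I).indexEquiv e
    choose ρ hρ using fun i => htv (σ i).2
    refine ⟨ρ, fun hdet => ?_⟩
    have hli : LinearIndependent K (Matrix.of fun i j => v (ρ i) j).row := by
      have h1 : (Matrix.of fun i j => v (ρ i) j).row = fun i => ((σ i : t) : I → K) := by
        ext i j
        exact congrFun (hρ i) j
      rw [h1]
      exact htli.comp σ σ.injective
    have h2 := (Matrix.isUnit_iff_isUnit_det _).1 (Matrix.linearIndependent_rows_iff_isUnit.1 hli)
    refine h2.ne_zero ?_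
    have h3 := (algebraMap A K).map_det (Matrix.of fun i j => M (ρ i) j)
    rw [hdet, map_zero] at h3
    exact h3.symm

variable {L : Type*} [AddCommGroup L] [Module.Finite ℤ L] {B : LinearMap.BilinForm ℤ L}
  {G : Subgroup (L ≃ₗ[ℤ] L)}

/-- An entire function is zero exactly when all its Taylor coefficients along all lines through the
origin are; this turns a relation of functions into a system of linear equations. -/
lemma sum_taylorCoeff_eq_zero_iff {I : Type*} [Fintype I] {F : I → ℍ → Cplx L → ℂ}
    (hF : ∀ i, IsHolomorphic (F i)) (c : I → ℂ) (τ : ℍ) :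
    (∀ d w, ∑ i, c i * taylorCoeff (F i) d w τ = 0) ↔ ∀ z, ∑ i, c i * F i τ z = 0 := by
  have hd : ∀ w i, Differentiable ℂ fun s : ℂ => F i τ (s • w) := fun w i =>
    (hF i).differentiable_line τ w
  have hg : ∀ w, Differentiable ℂ fun s : ℂ => ∑ i, c i * F i τ (s • w) := fun w =>
    Differentiable.fun_sum fun i _ => (hd w i).const_mul (c i)
  have hder : ∀ w d, iteratedDeriv d (fun s : ℂ => ∑ i, c i * F i τ (s • w)) 0 =
      ∑ i, c i * taylorCoeff (F i) d w τ := fun w d => by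
    rw [iteratedDeriv_fun_sum fun i _ => ((hd w i).const_mul (c i)).contDiff.contDiffAt]
    refine Finset.sum_congr rfl fun i _ => ?_
    rw [iteratedDeriv_const_mul_field]
    rfl
  constructor
  · intro h z
    have h1 := Complex.hasSum_taylorSeries_of_entire (hg z) 0 1
    simp only [hder, h, smul_zero, one_smul] at h1
    exact h1.unique hasSum_zero
  · intro h d w
    rw [← hder]
    simp only [h]
    simp

/-- For finitely many weak Jacobi forms of the same index, either they are linearly dependent over
the ring of modular forms, or there is a nonzero modular form vanishing wherever their
restrictions are linearly dependent. -/
lemma exists_relation_or_modularForm {I : Type*} [Fintype I] {k : I → ℤ} {N : ℕ}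
    {ψ : I → ℍ → Cplx L → ℂ} (hψ : ∀ i, IsWeakJacobiForm B G (k i) N (ψ i)) :
    (∃ c : I → ModularFormRing, c ≠ 0 ∧ ∀ τ z, ∑ i, modEval τ (c i) * ψ i τ z = 0) ∨
      ∃ δ : ModularFormRing, δ ≠ 0 ∧ ∀ τ,
        (∃ c : I → ℂ, c ≠ 0 ∧ ∀ z, ∑ i, c i * ψ i τ z = 0) → modEval τ δ = 0 := by
  classical
  have hol := fun i => isHolomorphic_heatTwist (B := B) N (hψ i).holomorphic
  have hsum : ∀ (c : I → ℂ) τ z, ∑ i, c i * heatTwist B N (ψ i) τ z =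
      Complex.exp (N * Real.pi ^ 2 / 6 * EisensteinSeries.E2 τ * cform B z z) *
        ∑ i, c i * ψ i τ z := fun c τ z => by
    rw [Finset.mul_sum]
    exact Finset.sum_congr rfl fun i _ => mul_left_comm _ _ _
  choose M hM using fun (r : ℕ × Cplx L) i => (hψ i).exists_modularForm r.1 r.2
  refine (exists_relation_or_det_ne_zero M).imp ?_ ?_
  · rintro ⟨c, hc, hrel⟩
    refine ⟨c, hc, fun τ z => ?_⟩
    have h1 := (sum_taylorCoeff_eq_zero_iff hol (fun i => modEval τ (c i)) τ).1 (fun d w => by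
      have h := congrArg (modEval τ) (hrel (d, w))
      simpa only [map_sum, map_mul, map_zero, hM] using h) z
    rw [hsum] at h1
    exact (mul_eq_zero.1 h1).resolve_left (Complex.exp_ne_zero _)
  · rintro ⟨ρ, hρ⟩
    refine ⟨_, hρ, ?_⟩
    rintro τ ⟨c, hc, hrel⟩
    rw [RingHom.map_det]
    refine Matrix.exists_mulVec_eq_zero_iff.1 ⟨c, hc, ?_⟩
    ext i
    have h1 := (sum_taylorCoeff_eq_zero_iff hol c τ).2 (fun z => by rw [hsum, hrel, mul_zero])
      (ρ i).1 (ρ i).2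
    simp only [Matrix.mulVec, dotProduct, RingHom.mapMatrix_apply, Matrix.map_apply,
      Matrix.of_apply, hM, Pi.zero_apply]
    rw [← h1]
    exact Finset.sum_congr rfl fun j _ => mul_comm _ _

lemma modEval_eq_zero_of_nonempty_interior {δ : ModularFormRing}
    (h : (interior {τ : ℍ | modEval τ δ = 0}).Nonempty) : δ = 0 := by
  obtain ⟨τ₀, hτ₀⟩ := h
  have hU : IsOpen {x : ℂ | 0 < x.im} := isOpen_lt continuous_const Complex.continuous_im
  have han := (differentiableOn_modEval δ).analyticOnNhd hU
  have hev : (fun x => modEval (ofComplex x) δ) =ᶠ[nhds (τ₀ : ℂ)] 0 := by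
    have h1 : Filter.Tendsto (fun x : ℂ => ofComplex x) (nhds (τ₀ : ℂ)) (nhds τ₀) := by
      have h2 := (contMDiffAt_ofComplex (n := 0) τ₀.im_pos).continuousAt
      simpa [ContinuousAt] using h2
    filter_upwards [h1 (isOpen_interior.mem_nhds hτ₀)] with x hx
    have hx' : ofComplex x ∈ {τ : ℍ | modEval τ δ = 0} := interior_subset hx
    exact hx'
  refine modEval_eq_zero fun τ => ?_
  have := han.eqOn_zero_of_preconnected_of_eventuallyEq_zero
    (convex_halfSpace_im_gt 0).isPreconnected τ₀.im_pos hev τ.im_pos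
  simpa using this

/-- Families of weak Jacobi forms one of which is dependent at each point of the upper half plane
contain a family which is dependent over the ring of modular forms. -/
lemma exists_relation_of_pointwise {I : ℕ → Type*} [∀ s, Fintype (I s)] {k : ∀ s, I s → ℤ}
    {N : ℕ → ℕ} {ψ : ∀ s, I s → ℍ → Cplx L → ℂ}
    (hψ : ∀ s i, IsWeakJacobiForm B G (k s i) (N s) (ψ s i))
    (h : ∀ τ, ∃ (s : ℕ) (c : I s → ℂ), c ≠ 0 ∧ ∀ z, ∑ i, c i * ψ s i τ z = 0) :
    ∃ (s : ℕ) (c : I s → ModularFormRing), c ≠ 0 ∧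
      ∀ τ z, ∑ i, modEval τ (c i) * ψ s i τ z = 0 := by
  by_contra hcon
  have hδ := fun s => (exists_relation_or_modularForm (hψ s)).resolve_left fun h => hcon ⟨s, h⟩
  choose δ hδ0 hδ using hδ
  have hclosed : ∀ s, IsClosed {τ : ℍ | modEval τ (δ s) = 0} := fun s => by
    refine isClosed_eq ?_ continuous_const
    have h1 := (differentiableOn_modEval (δ s)).continuousOn.comp_continuous
      UpperHalfPlane.continuous_coe fun τ => τ.im_pos
    simpa [Function.comp_def] using h1
  -- Baire: the countably many closed zero sets of the `δ s` cover `ℍ`, so one has interior and that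
  -- `δ s` is zero.
  obtain ⟨s, hs⟩ := nonempty_interior_of_iUnion_of_closed hclosed (by
    refine Set.eq_univ_of_forall fun τ => ?_
    obtain ⟨s, hs⟩ := h τ
    exact Set.mem_iUnion.2 ⟨s, hδ s τ hs⟩)
  exact hδ0 s (modEval_eq_zero_of_nonempty_interior hs)

end

/-! ### Growth of quasi-periodic functions, and vanishing Jacobian implies dependence. -/

section

variable {L : Type*} [AddCommGroup L] {B : LinearMap.BilinForm ℤ L} {G : Subgroup (L ≃ₗ[ℤ] L)}

section Growth

/-- Quasi-periodicity of index `N` at `τ`, in linear coordinates. -/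
def IsQuasiPeriodic (B : LinearMap.BilinForm ℤ L) {l : ℕ} (b : Module.Basis (Fin l) ℂ (Cplx L))
    (τ : ℍ) (N : ℕ) (F : (Fin l → ℂ) → ℂ) : Prop :=
  ∀ (x y : L) (u : Fin l → ℂ), F (u + b.equivFun ((τ : ℂ) • incl x + incl y)) =
    Complex.exp (-(N * (Real.pi * Complex.I *
      (cform B (incl x) (incl x) * τ + 2 * cform B (incl x) (b.equivFun.symm u))))) * F u

lemma isGradedPredicate_isQuasiPeriodic {l : ℕ} (b : Module.Basis (Fin l) ℂ (Cplx L)) (τ : ℍ) :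
    IsGradedPredicate (IsQuasiPeriodic B b τ) where
  zero N x y u := by simp
  one x y u := by simp
  add N f g hf hg x y u := by rw [Pi.add_apply, hf, hg, Pi.add_apply, ← mul_add]
  smul N c f hf x y u := by rw [Pi.smul_apply, hf, Pi.smul_apply, smul_eq_mul, smul_eq_mul,
    mul_left_comm]
  mul N M f g hf hg x y u := by
    rw [Pi.mul_apply, hf, hg, Pi.mul_apply, Nat.cast_add, add_mul, neg_add, Complex.exp_add]
    ring

lemma IsWeakJacobiForm.isQuasiPeriodic {k : ℤ} {t : ℕ} {φ : ℍ → Cplx L → ℂ}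
    (hφ : IsWeakJacobiForm B G k t φ) {l : ℕ} (b : Module.Basis (Fin l) ℂ (Cplx L)) (τ : ℍ) :
    IsQuasiPeriodic B b τ t (sliceFun b φ τ) := by
  intro x y u
  have hs : ∀ u, sliceFun b φ τ u = φ τ (b.equivFun.symm u) := fun u => by
    rw [sliceFun, b.equivFun_symm_apply]
  rw [hs, hs, map_add, LinearEquiv.symm_apply_apply, ← add_assoc, hφ.quasiPeriodic]
  congr 2
  ring

variable [Module.Free ℤ L] [Module.Finite ℤ L]

/-- Reduction modulo the lattice `τL + L`. -/
lemma exists_lattice_reduction {l : ℕ} (b : Module.Basis (Fin l) ℂ (Cplx L)) (τ : ℍ) :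
    ∃ ρ : ℝ, 0 ≤ ρ ∧ ∀ R : ℝ, ∃ X : Set L, X.Finite ∧ ∀ u : Fin l → ℂ, ‖u‖ ≤ R →
      ∃ x ∈ X, ∃ (y : L) (w : Fin l → ℂ), ‖w‖ ≤ ρ ∧
        u = w + b.equivFun ((τ : ℂ) • incl x + incl y) := by
  let e := Module.finBasis ℤ L
  let E : Module.Basis _ ℂ (Cplx L) := Algebra.TensorProduct.basis ℂ e
  have hE : ∀ i, E i = incl (e i) := fun i => Algebra.TensorProduct.basis_apply e i
  let T : (Fin l → ℂ) →L[ℂ] (Fin (Module.finrank ℤ L) → ℂ) :=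
    LinearMap.toContinuousLinearMap (E.equivFun.toLinearMap ∘ₗ b.equivFun.symm.toLinearMap)
  have hT : ∀ u, b.equivFun.symm u = ∑ i, T u i • incl (e i) := fun u => by
    simp only [← hE]
    exact (E.sum_equivFun (b.equivFun.symm u)).symm
  have hincl : ∀ a : Fin (Module.finrank ℤ L) → ℤ,
      incl (∑ i, a i • e i) = ∑ i, (a i : ℂ) • incl (e i) := fun a => by
    simp only [incl, TensorProduct.tmul_sum]
    refine Finset.sum_congr rfl fun i _ => ?_
    rw [← TensorProduct.smul_tmul, TensorProduct.smul_tmul']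
    simp
  refine ⟨∑ i, (‖(τ : ℂ)‖ + 1) * ‖b.equivFun (incl (e i))‖, by positivity, fun R => ?_⟩
  -- The real coordinates `α` along `τL` are bounded by `‖T‖ R / Im τ`; the `+ 1` absorbs the floor.
  -- Those along `L` need no bound, as translation by `L` contributes no factor.
  set K : ℤ := ⌈‖T‖ * R / τ.im⌉ + 1 with hK
  refine ⟨(fun a : Fin (Module.finrank ℤ L) → ℤ => ∑ i, a i • e i) ''
    Set.Icc (fun _ => -K) (fun _ => K), (Set.finite_Icc _ _).image _, fun u hu => ?_⟩
  let α : Fin (Module.finrank ℤ L) → ℝ := fun i => (T u i).im / τ.im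
  let β : Fin (Module.finrank ℤ L) → ℝ := fun i => (T u i).re - α i * τ.re
  have hαβ : ∀ i, T u i = (α i : ℂ) * τ + β i := fun i => by
    have him := τ.im_pos.ne'
    refine Complex.ext ?_ ?_
    · simp [β]
    · simp [α, him]
  refine ⟨_, ⟨fun i => ⌊α i⌋, ⟨fun i => ?_, fun i => ?_⟩, rfl⟩, ∑ i, ⌊β i⌋ • e i,
    b.equivFun (∑ i, (((Int.fract (α i) : ℝ) : ℂ) * τ + ((Int.fract (β i) : ℝ) : ℂ)) • incl (e i)), ?_, ?_⟩
  · have h1 : |α i| ≤ ‖T‖ * R / τ.im := by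
      rw [abs_div, abs_of_pos τ.im_pos]
      have : |(T u i).im| ≤ ‖T‖ * R :=
        ((Complex.abs_im_le_norm _).trans (norm_le_pi_norm (T u) i)).trans
          ((T.le_opNorm u).trans (by gcongr))
      have := τ.im_pos
      gcongr
    have h2 := Int.le_ceil (‖T‖ * R / τ.im)
    have h3 := (abs_le.1 h1).1
    have h4 := Int.lt_floor_add_one (α i)
    have : (-K : ℝ) ≤ ⌊α i⌋ := by rw [hK]; push_cast; linarith
    exact_mod_cast this
  · have h1 : |α i| ≤ ‖T‖ * R / τ.im := by
      rw [abs_div, abs_of_pos τ.im_pos]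
      have : |(T u i).im| ≤ ‖T‖ * R :=
        ((Complex.abs_im_le_norm _).trans (norm_le_pi_norm (T u) i)).trans
          ((T.le_opNorm u).trans (by gcongr))
      have := τ.im_pos
      gcongr
    have h2 := Int.le_ceil (‖T‖ * R / τ.im)
    have h3 := (abs_le.1 h1).2
    have h4 := Int.floor_le (α i)
    have : (⌊α i⌋ : ℝ) ≤ K := by rw [hK]; push_cast; linarith
    exact_mod_cast this
  · rw [map_sum]
    refine (norm_sum_le _ _).trans (Finset.sum_le_sum fun i _ => ?_)
    rw [map_smul, norm_smul]
    gcongr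
    refine (norm_add_le _ _).trans ?_
    rw [norm_mul, Complex.norm_real, Complex.norm_real, Real.norm_eq_abs, Real.norm_eq_abs,
      Int.abs_fract, Int.abs_fract]
    have h1 := (Int.fract_lt_one (α i)).le
    have h2 := (Int.fract_lt_one (β i)).le
    exact add_le_add (mul_le_of_le_one_left (norm_nonneg _) h1) h2
  · rw [← map_add, ← LinearEquiv.symm_apply_eq, hT, hincl, hincl, Finset.smul_sum,
      ← Finset.sum_add_distrib, ← Finset.sum_add_distrib]
    refine Finset.sum_congr rfl fun i _ => ?_
    rw [smul_smul, ← add_smul, ← add_smul, hαβ]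
    congr 1
    have h1 : (α i : ℂ) = (⌊α i⌋ : ℂ) + ((Int.fract (α i) : ℝ) : ℂ) := by
      exact_mod_cast (Int.floor_add_fract (α i)).symm
    have h2 : (β i : ℂ) = (⌊β i⌋ : ℂ) + ((Int.fract (β i) : ℝ) : ℂ) := by
      exact_mod_cast (Int.floor_add_fract (β i)).symm
    linear_combination (τ : ℂ) * h1 + h2

/-- Points of a ball are reduced to a fixed ball by finitely many `x`, and each quasi-period factor
has exponent linear in `N`. Thus `A` depends on `R` but neither on `N` nor on `F`. -/
lemma isQuasiPeriodic_growth {l : ℕ} (b : Module.Basis (Fin l) ℂ (Cplx L)) (τ : ℍ) :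
    ∃ ρ : ℝ, 0 ≤ ρ ∧ ∀ R : ℝ, ∃ A : ℝ, ∀ N F, IsQuasiPeriodic B b τ N F → ∀ u, ‖u‖ ≤ R →
      ∃ w, ‖w‖ ≤ ρ ∧ ‖F u‖ ≤ Real.exp (A * N) * ‖F w‖ := by
  obtain ⟨ρ, hρ, h⟩ := exists_lattice_reduction b τ
  refine ⟨ρ, hρ, fun R => ?_⟩
  obtain ⟨X, hX, hred⟩ := h R
  let S : L → (Fin l → ℂ) →L[ℂ] ℂ := fun x =>
    LinearMap.toContinuousLinearMap (cform B (incl x) ∘ₗ b.equivFun.symm.toLinearMap)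
  obtain ⟨A, hA⟩ := (hX.image fun x =>
    Real.pi * (‖cform B (incl x) (incl x) * (τ : ℂ)‖ + 2 * (‖S x‖ * ρ))).bddAbove
  refine ⟨A, fun N F hF u hu => ?_⟩
  obtain ⟨x, hx, y, w, hw, rfl⟩ := hred u hu
  refine ⟨w, hw, ?_⟩
  rw [hF, norm_mul]
  gcongr
  refine (Complex.norm_exp_le_exp_norm _).trans (Real.exp_le_exp.2 ?_)
  rw [norm_neg, norm_mul, norm_mul, norm_mul, Complex.norm_natCast, Complex.norm_I,
    Complex.norm_real, Real.norm_of_nonneg Real.pi_pos.le, mul_one, mul_comm A]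
  gcongr
  have hAx : Real.pi * (‖cform B (incl x) (incl x) * (τ : ℂ)‖ + 2 * (‖S x‖ * ρ)) ≤ A :=
    hA ⟨x, hx, rfl⟩
  refine le_trans ?_ hAx
  gcongr
  refine (norm_add_le _ _).trans ?_
  rw [norm_mul 2, Complex.norm_ofNat]
  gcongr
  exact ((S x).le_opNorm w).trans (by gcongr)

end Growth

/-- A linear relation between distinct monomials is a polynomial relation. -/
lemma exists_polyEval_eq_zero_of_relation {J I : Type*} [Fintype J] [Fintype I]
    {φ : J → ℍ → Cplx L → ℂ} {α : I → J → ℕ} (hα : Function.Injective α)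
    {c : I → ModularFormRing} (hc : c ≠ 0)
    (h : ∀ τ z, ∑ i, modEval τ (c i) * ∏ j, φ j τ z ^ α i j = 0) :
    ∃ P, polyEval φ P = 0 ∧ P ≠ 0 := by
  classical
  let α' : I → J →₀ ℕ := fun i => Finsupp.equivFunOnFinite.symm (α i)
  have hα' : Function.Injective α' := Finsupp.equivFunOnFinite.symm.injective.comp hα
  refine ⟨∑ i, MvPolynomial.monomial (α' i) (c i), ?_, fun h0 => hc ?_⟩
  · ext τ z
    rw [polyEval, MvPolynomial.eval₂_sum, Pi.zero_apply, Pi.zero_apply, ← h τ z]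
    refine Finset.sum_congr rfl fun i _ => ?_
    rw [MvPolynomial.eval₂_monomial, Finsupp.prod_fintype _ _ fun j => pow_zero _]
    rfl
  · ext1 i
    have h1 := congrArg (MvPolynomial.coeff (α' i)) h0
    rw [MvPolynomial.coeff_sum, Finset.sum_eq_single i, MvPolynomial.coeff_monomial, if_pos rfl] at h1
    · simpa using h1
    · intro j _ hj
      rw [MvPolynomial.coeff_monomial, if_neg fun h => hj (hα' h)]
    · simp

variable [Module.Free ℤ L] [Module.Finite ℤ L]

/-- A weak Jacobi form of index zero does not depend on the lattice variable. -/
lemma IsWeakJacobiForm.eq_of_index_zero {k : ℤ} {φ : ℍ → Cplx L → ℂ}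
    (hφ : IsWeakJacobiForm B G k 0 φ) (τ : ℍ) (z : Cplx L) : φ τ z = φ τ 0 := by
  have b := Module.finBasis ℂ (Cplx L)
  obtain ⟨ρ, hρ, hgrowth⟩ := isQuasiPeriodic_growth (B := B) b τ
  have hq := hφ.isQuasiPeriodic b τ
  -- For `N = 0` the growth factor is 1, so the values are bounded by those on a compact ball and
  -- Liouville's theorem applies.
  have hb : Bornology.IsBounded (Set.range (sliceFun b φ τ)) := by
    obtain ⟨M, hM⟩ := ((isCompact_closedBall (0 : Fin _ → ℂ) ρ).image
      (hφ.holomorphic.differentiable_sliceFun b τ).continuous).isBounded.exists_norm_le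
    refine (Metric.isBounded_closedBall (x := (0 : ℂ)) (r := M)).subset ?_
    rintro _ ⟨u, rfl⟩
    obtain ⟨A, hA⟩ := hgrowth ‖u‖
    obtain ⟨w, hw, h⟩ := hA 0 _ hq u le_rfl
    rw [mem_closedBall_zero_iff]
    refine h.trans ?_
    simpa using hM _ ⟨w, by simpa using hw, rfl⟩
  have h := (hφ.holomorphic.differentiable_sliceFun b τ).apply_eq_apply_of_bounded hb
    (b.equivFun z) 0
  simpa [sliceFun, b.sum_repr] using h

lemma exists_pointwise_relation {n : ℕ} (b : Module.Basis (Fin (n + 1)) ℂ (Cplx L))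
    {k : Fin (n + 2) → ℤ} {m : Fin (n + 2) → ℕ} {φ : Fin (n + 2) → ℍ → Cplx L → ℂ}
    (hφ : ∀ j, IsWeakJacobiForm B G (k j) (m j) (φ j)) (hm : ∀ j, m j ≠ 0)
    (hJ : jacobian b m φ = 0) (τ : ℍ) :
    ∃ s, ∃ c : (Fin (n + 1) → Fin (s + 1)) → ℂ, c ≠ 0 ∧
      ∀ z, ∑ a, c a * ∏ j, φ j τ z ^ boxExponent m s a j = 0 := by
  obtain ⟨ρ, hρ, hgrowth⟩ := isQuasiPeriodic_growth (B := B) b τ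
  obtain ⟨s, c, hc, h⟩ := exists_box_relation (f := fun j => sliceFun b (φ j) τ)
    (fun j => (hφ j).holomorphic.differentiable_sliceFun b τ) hm (fun y => by
      have h1 := congrFun (congrFun hJ τ) (∑ i, y i • b i)
      rw [jacobian, Pi.zero_apply, Pi.zero_apply] at h1
      rw [← h1]
      congr 1
      ext i j
      refine Fin.cases ?_ (fun i => ?_) i
      · rfl
      · exact ((hφ j).holomorphic.partialZ_eq b τ y i).symm)
    (isGradedPredicate_isQuasiPeriodic (B := B) b τ) (fun j => (hφ j).isQuasiPeriodic b τ) hρ hgrowth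
  refine ⟨s, c, hc, fun z => ?_⟩
  have := h (b.equivFun z)
  simpa only [sliceFun, b.sum_equivFun] using this

/-- For positive indices the pointwise relations among box monomials are lifted to modular
coefficients. An index zero is treated separately, since the count of monomials of a common index
then breaks down. -/
lemma jacobian_ne_zero_of_algIndep {l : ℕ} (hl : 0 < l) (b : Module.Basis (Fin l) ℂ (Cplx L))
    {k : Fin (l + 1) → ℤ} {m : Fin (l + 1) → ℕ} {φ : Fin (l + 1) → ℍ → Cplx L → ℂ}
    (hφ : ∀ j, IsWeakJacobiForm B G (k j) (m j) (φ j)) (hind : AlgIndepOverModularForms φ) :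
    jacobian b m φ ≠ 0 := by
  classical
  obtain ⟨n, rfl⟩ := Nat.exists_eq_succ_of_ne_zero hl.ne'
  intro hJ
  rw [algIndep_iff] at hind
  suffices h : ∃ (I : Type) (_ : Fintype I) (α : I → Fin (n + 2) → ℕ) (c : I → ModularFormRing),
      Function.Injective α ∧ c ≠ 0 ∧
        ∀ τ z, ∑ i, modEval τ (c i) * ∏ j, φ j τ z ^ α i j = 0 by
    obtain ⟨I, _, α, c, hα, hc, h⟩ := h
    obtain ⟨P, hP, hP0⟩ := exists_polyEval_eq_zero_of_relation hα hc h
    exact hP0 (hind P hP)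
  by_cases hm : ∀ j, m j ≠ 0
  · obtain ⟨s, c, hc, h⟩ := exists_relation_of_pointwise (B := B) (G := G)
      (I := fun s => Fin (n + 1) → Fin (s + 1))
      (N := fun s => (∏ j, m j) * ((n + 1) * s))
      (k := fun s a => ∑ j, boxExponent m s a j * k j)
      (ψ := fun s a τ z => ∏ j, φ j τ z ^ boxExponent m s a j)
      (fun s a => by
        rw [← sum_boxExponent m s a]
        exact IsWeakJacobiForm.prod_pow hφ _ _)
      (exists_pointwise_relation b hφ hm hJ)
    exact ⟨_, inferInstance, _, c, boxExponent_injective hm s, hc, h⟩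
  · push Not at hm
    obtain ⟨j₀, hj₀⟩ := hm
    obtain ⟨s, c, hc, h⟩ := exists_relation_of_pointwise (B := B) (G := G)
      (I := fun _ => Fin 2) (N := fun _ => 0)
      (k := fun _ i => ∑ j, (Pi.single j₀ (i : ℕ) : Fin (n + 2) → ℕ) j * k j)
      (ψ := fun _ i τ z => ∏ j, φ j τ z ^ (Pi.single j₀ (i : ℕ) : Fin (n + 2) → ℕ) j)
      (fun s i => by
        have h1 : ∑ j, (Pi.single j₀ (i : ℕ) : Fin (n + 2) → ℕ) j * m j = 0 :=
          Finset.sum_eq_zero fun j _ => by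
            by_cases hj : j = j₀
            · rw [hj, hj₀, mul_zero]
            · rw [Pi.single_eq_of_ne hj, zero_mul]
        have h2 := IsWeakJacobiForm.prod_pow hφ (Pi.single j₀ (i : ℕ)) Finset.univ
        rwa [h1] at h2)
      (fun τ => by
        -- At each `τ` a form of index 0 is the constant `φ j₀ τ 0`, hence proportional to the
        -- monomial 1.
        refine ⟨0, ![-φ j₀ τ 0, 1], fun h => one_ne_zero (congrFun h 1), fun z => ?_⟩
        have h3 : IsWeakJacobiForm B G (k j₀) 0 (φ j₀) := hj₀ ▸ hφ j₀
        have h4 : ∀ i : ℕ, ∏ j, φ j τ z ^ (Pi.single j₀ i : Fin (n + 2) → ℕ) j = φ j₀ τ z ^ i :=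
          fun i => by
            rw [Finset.prod_eq_single j₀ (fun j _ hj => by rw [Pi.single_eq_of_ne hj, pow_zero])
              (by simp), Pi.single_eq_same]
        simp only [h4, Fin.sum_univ_two]
        simp [h3.eq_of_index_zero τ z])
    refine ⟨_, inferInstance, _, c, fun i i' h => ?_, hc, h⟩
    have := congrFun h j₀
    simp only [Pi.single_eq_same] at this
    exact Fin.ext this

end

end LatticeJacobi

end

theorem proposition2p1 {L : Type*} [AddCommGroup L] [Module.Free ℤ L] [Module.Finite ℤ L]
    (B : LinearMap.BilinForm ℤ L) (hB : LatticeJacobi.IsEvenPosDef B)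
    (G : Subgroup (L ≃ₗ[ℤ] L)) (hG : G ≤ LatticeJacobi.orthogonalGroup B)
    (l : ℕ) (hl : Module.finrank ℤ L = l)
    (b : Module.Basis (Fin l) ℂ (LatticeJacobi.Cplx L))
    (k : Fin (l + 1) → ℤ) (m : Fin (l + 1) → ℕ)
    (φ : Fin (l + 1) → UpperHalfPlane → LatticeJacobi.Cplx L → ℂ)
    (hφ : ∀ j, LatticeJacobi.IsWeakJacobiForm B G (k j) (m j) (φ j)) :
    (LatticeJacobi.IsWeakJacobiForm B ⊥ ((l : ℤ) + ∑ j, k j) (∑ j, m j)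
        (LatticeJacobi.jacobian b m φ) ∧
      ∀ σ ∈ G, ∀ (τ : UpperHalfPlane) (z : LatticeJacobi.Cplx L),
        LatticeJacobi.jacobian b m φ τ (LatticeJacobi.cact σ z) =
          ((LinearMap.det (σ : L →ₗ[ℤ] L) : ℤ) : ℂ) * LatticeJacobi.jacobian b m φ τ z) ∧
    (0 < l →
      (LatticeJacobi.jacobian b m φ ≠ 0 ↔ LatticeJacobi.AlgIndepOverModularForms φ)) ∧
    (∀ r : L, LatticeJacobi.IsPrimitiveVector r →
      (∃ σ ∈ G, ∀ v, LatticeJacobi.cact σ v = LatticeJacobi.reflect B r v) →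
      ∀ p ∈ LatticeJacobi.mirrors B r, LatticeJacobi.jacobian b m φ p.1 p.2 = 0) := by
  refine ⟨⟨LatticeJacobi.isWeakJacobiForm_jacobian b hB hφ, fun σ hσ τ z =>
    LatticeJacobi.jacobian_cact b hφ hσ τ z⟩, fun hl0 => ?_, ?_⟩
  -- Separating the indices needs a nonzero translation vector; in rank 0 a nonzero Jacobian would
  -- not imply independence.
  · have : Nontrivial L := Module.nontrivial_of_finrank_pos (R := ℤ) (hl ▸ hl0)
    exact ⟨LatticeJacobi.algIndep_of_jacobian_ne_zero hB b hφ,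
      LatticeJacobi.jacobian_ne_zero_of_algIndep hl0 b hφ⟩
  · rintro r hr ⟨σ, hσG, hσ⟩ p hp
    exact LatticeJacobi.jacobian_eq_zero_on_mirrors b hB hφ hr.1 hσG hσ hp
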